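/- **Setting.** Let $T,\kappa,\gamma,\rho,y,\lambda,\phi,\varrho>0$ and let $(\Omega,\mathcal F,(\mathcal F_t)_{0\le t\le T},\mathbb P)$ be a filtered probability space satisfying the usual conditions. Let $P=L+A$ on $[0,T]$ with $L$ a càdlàg local martingale, $A$ a predictable càdlàg finite-variation process with $A_0=0$, $E[\langle L\rangle_T]+E[(\int_0^T|dA_s|)^2]<\infty$ (where $\langle L\rangle_0=0$) and $E|P_0|<\infty$. Let $\mathcal A$ be the set of progressively measurable $v$ with $E[\int_0^T v_s^2\,ds]<\infty$. Agents $i\in\mathbb N$ have initial positions $x^i\in\mathbb R$ with $\tilde x=\lim_{N}\frac1N\sum_{i=1}^N x^i\in\mathbb R$ existing. For $v,\nu\in\mathcal A$ put $$X^{v}_t=x^i-\int_0^t v_s\,ds\quad(\text{for agent } i),\qquad Y^\nu_t=e^{-\rho t}y+\gamma\int_0^te^{-\rho(t-s)}\nu_s\,ds,$$ $$J^{i}(v;\nu)=E\Big[\int_0^T(P_t-\kappa Y^\nu_t)v_t\,dt-\lambda\int_0^Tv_t^2\,dt-\phi\int_0^T(X^v_t)^2dt+X^v_T(P_T-\varrho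 X^v_T)\Big].$$ A collection $(\hat v^i)_{i\in\mathbb N}\subset\mathcal A$ is a Nash equilibrium of the infinite player mean field game if there is $\hat\nu\in\mathcal A$ (its net trading flow) with $\hat\nu_t=\lim_N\frac1N\sum_{i=1}^N\hat v^i_t$ $d\mathbb P\otimes dt$-a.e. on $\Omega\times[0,T]$, such that $\hat v^i$ maximizes $J^i(\cdot;\hat\nu)$ over $\mathcal A$ for every $i$. Let $(\tilde X,\tilde Y,\tilde\nu)$ with $\tilde\nu\in\mathcal A$ be a solution of the mean field system $$d\tilde X_t=-\tilde\nu_t\,dt,\ \tilde X_0=\tilde x,\qquad d\tilde Y_t=-\rho\tilde Y_t\,dt+\gamma\tilde\nu_t\,dt,\ \tilde Y_0=y,$$ $$d\tilde\nu_t=\frac{dP_t}{2\lambda}+\frac{\kappa\rho}{2\lambda}\tilde Y_t\,dt-\frac{\kappa\gamma}{2\lambda}\tilde\nu_t\,dt-\frac{\phi}{\lambda}\tilde X_t\,dt+d\tilde L_t,\qquad \tilde\nu_T=\frac{\varrho}{\lambda}\tilde X_T-\frac{\kappa}{2\lambda}\tilde Y_T,$$ for some càdlàg square-integrable martingale $\tilde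 L$ on $[0,T]$, and let $$R(t)=\sqrt{\phi/\lambda}\,\cosh(\sqrt{\phi/\lambda}\,t)+\frac{\varrho}{\lambda}\sinh(\sqrt{\phi/\lambda}\,t).$$ **Corollary 3.7.** There is a Nash equilibrium with càdlàg strategies whose net trading flow is $\tilde\nu$. Every Nash equilibrium $(\hat v^i)_{i\in\mathbb N}$ satisfies, for each $i\in\mathbb N$, $$\hat v^i_t=\tilde\nu_t-\frac{R'(T-t)}{R(T-t)}\big(\tilde X_t-X^{\hat v^i}_t\big)$$ for $d\mathbb P\otimes dt$-almost every $(\omega,t)\in\Omega\times[0,T]$, and, if $\hat v^i$ has càdlàg paths on $[0,T]$ almost surely, then almost surely for all $t\in(0,T)$. Moreover $R(T-t)>0$ and $R'(T-t)/R(T-t)>0$ for all $t\in[0,T]$, so each agent's inventory is pulled toward the mean field inventory. -/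

import Mathlib

open MeasureTheory ProbabilityTheory Filter
open scoped NNReal ENNReal Topology

noncomputable section

/-! Processes on the finite horizon `[0,T]` are functions `X : ℝ → Ω → ℝ`; only their values at
times `t ∈ [0,T]` ever matter. Filtrations are indexed by `ℝ≥0`, and likewise only `ℱ t` for
`t ∈ [0,T]` matters. -/

namespace LiquidationGame

/-- The constants of the model: horizon `T`, price impact constants `κ`, `γ`, resilience `ρ`,
initial price distortion `y`, slippage cost `lam`, usually written λ, running inventory
penalty `φ` and terminal inventory penalty `varrho`. -/
structure Params where
  T : ℝ
  κ : ℝ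
  γ : ℝ
  ρ : ℝ
  y : ℝ
  lam : ℝ
  φ : ℝ
  varrho : ℝ
  T_pos : 0 < T
  κ_pos : 0 < κ
  γ_pos : 0 < γ
  ρ_pos : 0 < ρ
  y_pos : 0 < y
  lam_pos : 0 < lam
  φ_pos : 0 < φ
  varrho_pos : 0 < varrho

section Stochastic

variable {Ω : Type*} {mΩ : MeasurableSpace Ω}

/-- The usual conditions: the filtration is right continuous, and `ℱ 0` contains every subset of
a null set (`μ` is an outer measure on all sets, so `s` need not be measurable a priori). -/
structure UsualConditions (ℱ : Filtration ℝ≥0 mΩ) (μ : Measure Ω) : Prop where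
  rightContinuous : ℱ.IsRightContinuous
  complete : ∀ s : Set Ω, μ s = 0 → MeasurableSet[ℱ 0] s

/-- The process `(X_t)_{0 ≤ t ≤ T}`, continued by the constant `X_T` after `T`. A property that is
stable under stopping holds for this process iff it holds on `[0,T]`. -/
def stopAt {E : Type*} (T : ℝ) (X : ℝ → Ω → E) : ℝ≥0 → Ω → E :=
  fun t ω => X (min (t : ℝ) T) ω

/-- The path `f` is right continuous with left limits on `[0,T]`. -/
def IsCadlagOn {E : Type*} [TopologicalSpace E] (T : ℝ) (f : ℝ → E) : Prop :=
  (∀ t ∈ Set.Ico 0 T, ContinuousWithinAt f (Set.Ici t) t) ∧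
    ∀ t ∈ Set.Ioc 0 T, ∃ l, Tendsto f (𝓝[<] t) (𝓝 l)

/-- `(M_t)_{0 ≤ t ≤ T}` is a càdlàg local martingale. -/
structure IsLocalMartingale {E : Type*} [NormedAddCommGroup E] [NormedSpace ℝ E]
    (T : ℝ) (ℱ : Filtration ℝ≥0 mΩ) (μ : Measure Ω) (M : ℝ → Ω → E) : Prop where
  cadlag : ∀ᵐ ω ∂μ, IsCadlagOn T (fun t => M t ω)
  locally_martingale : Locally (fun Z : ℝ≥0 → Ω → E => Martingale Z ℱ μ) ℱ (stopAt T M) μ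

/-- `(M_t)_{0 ≤ t ≤ T}` is a càdlàg square-integrable martingale. -/
structure IsSquareIntegrableMartingale
    (T : ℝ) (ℱ : Filtration ℝ≥0 mΩ) (μ : Measure Ω) (M : ℝ → Ω → ℝ) : Prop where
  cadlag : ∀ᵐ ω ∂μ, IsCadlagOn T (fun t => M t ω)
  martingale : Martingale (stopAt T M) ℱ μ
  memLp : ∀ t ∈ Set.Icc 0 T, MemLp (M t) 2 μ

/-- `L` is a local martingale on `[0,T]` and `C` is its predictable quadratic variation `⟨L⟩`: the
predictable nondecreasing càdlàg process with `C_0 = 0` for which `(L - L_0)^2 - C` is a local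
martingale. (That `L` and `(L - L_0)^2 - C` are both local martingales is expressed by saying that
the pair is an `ℝ × ℝ`-valued one: take the minimum of two localizing sequences.) -/
structure HasPredictableQuadraticVariation
    (T : ℝ) (ℱ : Filtration ℝ≥0 mΩ) (μ : Measure Ω) (L C : ℝ → Ω → ℝ) : Prop where
  predictable : IsStronglyPredictable ℱ (stopAt T C)
  zero : ∀ᵐ ω ∂μ, C 0 ω = 0
  cadlag : ∀ᵐ ω ∂μ, IsCadlagOn T (fun t => C t ω)
  mono : ∀ᵐ ω ∂μ, MonotoneOn (fun t => C t ω) (Set.Icc 0 T)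
  localMartingale :
    IsLocalMartingale T ℱ μ (fun t ω => (L t ω, (L t ω - L 0 ω) ^ 2 - C t ω))

/-- The class `ℋ²`: special semimartingales `P = L + A` on `[0,T]`, with `L` a local martingale and
`A` a predictable process of finite variation null at `0`, such that
`E[⟨L⟩_T] + E[(∫_0^T |dA_s|)^2] < ∞`, and with integrable initial value. -/
def IsH2 (T : ℝ) (ℱ : Filtration ℝ≥0 mΩ) (μ : Measure Ω) (P : ℝ → Ω → ℝ) : Prop :=
  Integrable (P 0) μ ∧
  ∃ L A C : ℝ → Ω → ℝ,
    (∀ᵐ ω ∂μ, ∀ t ∈ Set.Icc 0 T, P t ω = L t ω + A t ω) ∧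
    HasPredictableQuadraticVariation T ℱ μ L C ∧
    IsStronglyPredictable ℱ (stopAt T A) ∧
    (∀ᵐ ω ∂μ, A 0 ω = 0) ∧
    (∀ᵐ ω ∂μ, IsCadlagOn T (fun t => A t ω)) ∧
    (∫⁻ ω, ENNReal.ofReal (C T ω) ∂μ) < ∞ ∧
    (∫⁻ ω, eVariationOn (fun t => A t ω) (Set.Icc 0 T) ^ 2 ∂μ) < ∞

/-- The set `𝒜` of admissible rates: progressively measurable `v` with
`E[∫_0^T v_s^2 ds] < ∞`. -/
structure Admissible (T : ℝ) (ℱ : Filtration ℝ≥0 mΩ) (μ : Measure Ω) (v : ℝ → Ω → ℝ) : Prop where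
  progressive : IsStronglyProgressive ℱ (stopAt T v)
  square_integrable : (∫⁻ ω, (∫⁻ t in Set.Icc 0 T, ENNReal.ofReal (v t ω ^ 2)) ∂μ) < ∞

/-- The inventory `X^v_t = x - ∫_0^t v_s ds`. -/
def inventory (x : ℝ) (v : ℝ → Ω → ℝ) (t : ℝ) (ω : Ω) : ℝ :=
  x - ∫ s in (0 : ℝ)..t, v s ω

/-- The transient price distortion `Y^ν_t = e^{-ρt} y + γ ∫_0^t e^{-ρ(t-s)} ν_s ds`. -/
def distortion (p : Params) (ν : ℝ → Ω → ℝ) (t : ℝ) (ω : Ω) : ℝ :=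
  Real.exp (-p.ρ * t) * p.y + p.γ * ∫ s in (0 : ℝ)..t, Real.exp (-p.ρ * (t - s)) * ν s ω

/-- The execution price `S^ν_t = P_t - κ Y^ν_t`. -/
def executionPrice (p : Params) (P ν : ℝ → Ω → ℝ) (t : ℝ) (ω : Ω) : ℝ :=
  P t ω - p.κ * distortion p ν t ω

/-- The performance functional of an agent with initial position `x` who trades at rate `v`
against the net trading flow `ν`. -/
def objective (p : Params) (μ : Measure Ω) (P : ℝ → Ω → ℝ) (x : ℝ) (v ν : ℝ → Ω → ℝ) : ℝ :=
  ∫ ω, ((∫ t in (0 : ℝ)..p.T, executionPrice p P ν t ω * v t ω)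
      - p.lam * (∫ t in (0 : ℝ)..p.T, v t ω ^ 2)
      - p.φ * (∫ t in (0 : ℝ)..p.T, inventory x v t ω ^ 2)
      + inventory x v p.T ω * (P p.T ω - p.varrho * inventory x v p.T ω)) ∂μ

/-- The product measure `dℙ ⊗ dt` on `Ω × [0,T]`. -/
def timeMeasure (T : ℝ) (μ : Measure Ω) : Measure (Ω × ℝ) :=
  μ.prod (volume.restrict (Set.Icc 0 T))

/-- The collection of strategies `v` is a Nash equilibrium of the infinite player mean field game
with initial positions `x`, and `ν` is the associated net trading flow: `ν` is the limit of the
averaged rates, and each `v i` maximizes the objective of agent `i` given `ν`. -/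
structure IsNashEquilibrium (p : Params) (ℱ : Filtration ℝ≥0 mΩ) (μ : Measure Ω)
    (P : ℝ → Ω → ℝ) (x : ℕ → ℝ) (v : ℕ → ℝ → Ω → ℝ) (ν : ℝ → Ω → ℝ) : Prop where
  admissible : ∀ i, Admissible p.T ℱ μ (v i)
  admissible_flow : Admissible p.T ℱ μ ν
  consistent : ∀ᵐ q ∂(timeMeasure p.T μ),
    Tendsto (fun N : ℕ => (∑ i ∈ Finset.range N, v i q.2 q.1) / (N : ℝ)) atTop (𝓝 (ν q.2 q.1))
  optimal : ∀ i, ∀ w, Admissible p.T ℱ μ w →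
    objective p μ P (x i) w ν ≤ objective p μ P (x i) (v i) ν

/-- `(X, Y, ν)` solves the mean field forward backward system
`dX = -ν dt`, `X_0 = x0`,
`dY = -ρ Y dt + γ ν dt`, `Y_0 = y`,
`dν = dP/(2λ) + κρ/(2λ) Y dt - κγ/(2λ) ν dt - φ/λ X dt + dM`, `ν_T = (ϱ/λ) X_T - κ/(2λ) Y_T`,
with `ν ∈ 𝒜` and some square-integrable martingale `M`. -/
structure IsMeanFieldSolution (p : Params) (ℱ : Filtration ℝ≥0 mΩ) (μ : Measure Ω)
    (P : ℝ → Ω → ℝ) (x0 : ℝ) (X Y ν : ℝ → Ω → ℝ) : Prop where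
  admissible : Admissible p.T ℱ μ ν
  forward_X : ∀ᵐ ω ∂μ, ∀ t ∈ Set.Icc 0 p.T, X t ω = x0 - ∫ s in (0 : ℝ)..t, ν s ω
  continuous_Y : ∀ᵐ ω ∂μ, ContinuousOn (fun t => Y t ω) (Set.Icc 0 p.T)
  forward_Y : ∀ᵐ ω ∂μ, ∀ t ∈ Set.Icc 0 p.T,
    Y t ω = p.y + ∫ s in (0 : ℝ)..t, (-p.ρ * Y s ω + p.γ * ν s ω)
  backward_ν : ∃ M : ℝ → Ω → ℝ, IsSquareIntegrableMartingale p.T ℱ μ M ∧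
    ∀ᵐ ω ∂μ, ∀ t ∈ Set.Icc 0 p.T,
      ν t ω = ν 0 ω + (P t ω - P 0 ω) / (2 * p.lam)
        + (∫ s in (0 : ℝ)..t, (p.κ * p.ρ / (2 * p.lam) * Y s ω
            - p.κ * p.γ / (2 * p.lam) * ν s ω - p.φ / p.lam * X s ω))
        + (M t ω - M 0 ω)
  terminal_ν : ∀ᵐ ω ∂μ,
    ν p.T ω = p.varrho / p.lam * X p.T ω - p.κ / (2 * p.lam) * Y p.T ω

end Stochastic

/-- `R(t) = √(φ/λ) cosh(√(φ/λ) t) + (ϱ/λ) sinh(√(φ/λ) t)`. -/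
def R (p : Params) (t : ℝ) : ℝ :=
  √(p.φ / p.lam) * Real.cosh (√(p.φ / p.lam) * t)
    + p.varrho / p.lam * Real.sinh (√(p.φ / p.lam) * t)

end LiquidationGame

end

set_option linter.unusedSectionVars false

/-! ### Calculus on a single path: integration by parts -/

namespace LiquidationGame

/-! The objective is a strictly concave quadratic functional of the agent's own rate, so optimality
is equivalent to a vanishing first variation. No backward equation has to be solved for an
individual agent: the mean field system already determines the price. In it the `Y` and `ν` drift is
`-κ/(2λ) dY`, so `2λ dν = dS - 2φX dt + 2λ dM` for the execution price `S = P - κY`. Integrating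
from `t` to `T` with the terminal condition gives `S_t = P_T + 2λν_t - 2φ∫_t^T X - 2ϱX_T + 2λ(M_T -
M_t)` (`executionPrice_eq`).

Let `h(t) = R'(T-t)/R(T)`, the optimal deterministic liquidation rate of one unit of inventory
(`unitRate_critical`). Write the rate of an agent with initial position `x` as `v = ν + (x - x̃)h +
ζ`, and let the actual flow be `ν'`. Inserting the formula for `S`, everything cancels in the first
variation in direction `w` except `-2E[energy(ζ, w)] - κE∫(Y^{ν'} - Y^ν)w`, since the martingale
increments are orthogonal to admissible rates (`objective_add`).

Existence: for `ν' = ν` and `ζ = 0` this vanishes, so `ν + (x^i - x̃)h` is optimal; averaging over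
the agents removes the correction, because the average of `x^i` tends to `x̃`.

Uniqueness: in an arbitrary equilibrium the price term is the same for all agents. Subtracting two
first order conditions and testing with `ζ^i - ζ^0` gives zero energy, so all `ζ^i` equal one
process `ζ`, and consistency forces `ν' = ν + ζ`. Testing with `ζ` itself, the price term is `κγ`
times the quadratic form of the exponential kernel, which is nonnegative
(`integral_exp_kernel_nonneg`), so `ζ = 0`.

Feedback form: the excess inventory `X^i - X̃` equals `(x^i - x̃)R(T-t)/R(T)`, hence `(x^i - x̃)h`
is `R'(T-t)/R(T-t)` times it. -/

theorem continuousOn_primitive_of_intervalIntegrable {T : ℝ} {f : ℝ → ℝ}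
    (hf : IntervalIntegrable f volume 0 T) :
    ContinuousOn (fun t => ∫ s in (0 : ℝ)..t, f s) (Set.uIcc 0 T) :=
  (hf.absolutelyContinuousOnInterval_intervalIntegral (c := 0) (by simp)).continuousOn

/-- Integration by parts for primitives of integrable functions. -/
theorem integral_add_mul_primitive {T : ℝ} {f g : ℝ → ℝ} (c d : ℝ)
    (hf : IntervalIntegrable f volume 0 T) (hg : IntervalIntegrable g volume 0 T) :
    (∫ t in (0 : ℝ)..T, f t * (d + ∫ s in (0 : ℝ)..t, g s))
      + (∫ t in (0 : ℝ)..T, (c + ∫ s in (0 : ℝ)..t, f s) * g t)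
      = (c + ∫ t in (0 : ℝ)..T, f t) * (d + ∫ t in (0 : ℝ)..T, g t) - c * d := by
  have hF := hf.absolutelyContinuousOnInterval_intervalIntegral (c := 0) (by simp)
  have hG := hg.absolutelyContinuousOnInterval_intervalIntegral (c := 0) (by simp)
  have key := hF.integral_deriv_mul_eq_sub hG
  have dF := hf.ae_hasDerivAt_integral
  have dG := hg.ae_hasDerivAt_integral
  have e : (∫ t in (0 : ℝ)..T, f t * (∫ s in (0 : ℝ)..t, g s) + (∫ s in (0 : ℝ)..t, f s) * g t)
      = (∫ t in (0 : ℝ)..T, f t) * (∫ t in (0 : ℝ)..T, g t) := by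
    rw [show (∫ t in (0 : ℝ)..T, f t) * (∫ t in (0 : ℝ)..T, g t) =
      (∫ t in (0 : ℝ)..T, f t) * (∫ t in (0 : ℝ)..T, g t)
      - (∫ t in (0 : ℝ)..0, f t) * (∫ t in (0 : ℝ)..0, g t) by simp, ← key]
    apply intervalIntegral.integral_congr_ae
    filter_upwards [dF, dG] with t h1 h2 ht
    rw [(h1 (Set.uIoc_subset_uIcc ht) 0 (by simp)).deriv,
      (h2 (Set.uIoc_subset_uIcc ht) 0 (by simp)).deriv]
  have i1 : IntervalIntegrable (fun t => f t * ∫ s in (0 : ℝ)..t, g s) volume 0 T :=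
    hf.mul_continuousOn hG.continuousOn
  have i2 : IntervalIntegrable (fun t => (∫ s in (0 : ℝ)..t, f s) * g t) volume 0 T :=
    hg.continuousOn_mul hF.continuousOn
  rw [intervalIntegral.integral_add i1 i2] at e
  simp only [mul_add, add_mul]
  rw [intervalIntegral.integral_add (hf.mul_const d) i1,
    intervalIntegral.integral_add (hg.const_mul c) i2]
  simp only [intervalIntegral.integral_mul_const, intervalIntegral.integral_const_mul]
  linarith

/-- A function with continuous derivative times a primitive. -/
theorem integral_mul_primitive_of_hasDerivAt {T : ℝ} {f f' w : ℝ → ℝ}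
    (hf : ∀ t, HasDerivAt f (f' t) t) (hf' : Continuous f')
    (hw : IntervalIntegrable w volume 0 T) (d : ℝ) :
    (∫ t in (0 : ℝ)..T, f' t * (d + ∫ s in (0 : ℝ)..t, w s))
      = f T * (d + ∫ t in (0 : ℝ)..T, w t) - f 0 * d - ∫ t in (0 : ℝ)..T, f t * w t := by
  have h : ∀ t, f 0 + ∫ s in (0 : ℝ)..t, f' s = f t := fun t => by
    rw [intervalIntegral.integral_eq_sub_of_hasDerivAt (fun s _ => hf s)
      (hf'.intervalIntegrable _ _)]
    ring
  have := integral_add_mul_primitive (f 0) d (hf'.intervalIntegrable 0 T) hw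
  simp only [h] at this
  linarith

/-- Fubini on the triangle `s ≤ t`. It matches the term `∫_t^T X` of the price with the marginal
running inventory cost. -/
theorem integral_mul_primitive_swap {T : ℝ} {f w : ℝ → ℝ}
    (hf : IntervalIntegrable f volume 0 T) (hw : IntervalIntegrable w volume 0 T) :
    (∫ t in (0 : ℝ)..T, f t * ∫ s in (0 : ℝ)..t, w s)
      = ∫ t in (0 : ℝ)..T, ((∫ s in (0 : ℝ)..T, f s) - ∫ s in (0 : ℝ)..t, f s) * w t := by
  have := integral_add_mul_primitive 0 0 hf hw
  simp only [zero_add, mul_zero, sub_zero] at this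
  simp only [sub_mul]
  rw [intervalIntegral.integral_sub (hw.const_mul _)
    (hw.continuousOn_mul (continuousOn_primitive_of_intervalIntegrable hf)),
    intervalIntegral.integral_const_mul]
  linarith

/-! ### The function `R` and deterministic liquidation -/

theorem hasDerivAt_R (p : Params) (t : ℝ) :
    HasDerivAt (R p) (√(p.φ / p.lam) * (√(p.φ / p.lam) * Real.sinh (√(p.φ / p.lam) * t))
      + p.varrho / p.lam * (√(p.φ / p.lam) * Real.cosh (√(p.φ / p.lam) * t))) t := by
  have h1 : HasDerivAt (fun t : ℝ => √(p.φ / p.lam) * t) (√(p.φ / p.lam)) t := by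
    simpa using (hasDerivAt_id t).const_mul (√(p.φ / p.lam))
  refine HasDerivAt.congr_deriv (((h1.cosh.const_mul _).add (h1.sinh.const_mul _))) ?_
  ring

theorem deriv_R (p : Params) : deriv (R p) =
    fun t => √(p.φ / p.lam) * (√(p.φ / p.lam) * Real.sinh (√(p.φ / p.lam) * t))
      + p.varrho / p.lam * (√(p.φ / p.lam) * Real.cosh (√(p.φ / p.lam) * t)) :=
  funext fun t => (hasDerivAt_R p t).deriv

/-- The Euler–Lagrange equation `λR'' = φR` of the deterministic problem. -/
theorem hasDerivAt_deriv_R (p : Params) (t : ℝ) :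
    HasDerivAt (deriv (R p)) (p.φ / p.lam * R p t) t := by
  have h1 : HasDerivAt (fun t : ℝ => √(p.φ / p.lam) * t) (√(p.φ / p.lam)) t := by
    simpa using (hasDerivAt_id t).const_mul (√(p.φ / p.lam))
  have h2 : √(p.φ / p.lam) * √(p.φ / p.lam) = p.φ / p.lam :=
    Real.mul_self_sqrt (div_pos p.φ_pos p.lam_pos).le
  rw [deriv_R]
  refine HasDerivAt.congr_deriv
    ((((h1.sinh.const_mul _).const_mul _).add ((h1.cosh.const_mul _).const_mul _))) ?_
  rw [R]
  linear_combination (√(p.φ / p.lam) * Real.cosh (√(p.φ / p.lam) * t)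
    + p.varrho / p.lam * Real.sinh (√(p.φ / p.lam) * t)) * h2

theorem continuous_R (p : Params) : Continuous (R p) :=
  continuous_iff_continuousAt.2 fun t => (hasDerivAt_R p t).continuousAt

theorem continuous_deriv_R (p : Params) : Continuous (deriv (R p)) :=
  continuous_iff_continuousAt.2 fun t => (hasDerivAt_deriv_R p t).continuousAt

theorem R_pos (p : Params) {t : ℝ} (ht : 0 ≤ t) : 0 < R p t := by
  have h : 0 < √(p.φ / p.lam) := Real.sqrt_pos.2 (div_pos p.φ_pos p.lam_pos)
  have h2 : 0 ≤ Real.sinh (√(p.φ / p.lam) * t) := Real.sinh_nonneg_iff.2 (mul_nonneg h.le ht)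
  have := mul_pos h (Real.cosh_pos (√(p.φ / p.lam) * t))
  have := mul_nonneg (div_pos p.varrho_pos p.lam_pos).le h2
  rw [R]; linarith

theorem deriv_R_pos (p : Params) {t : ℝ} (ht : 0 ≤ t) : 0 < deriv (R p) t := by
  have h : 0 < √(p.φ / p.lam) := Real.sqrt_pos.2 (div_pos p.φ_pos p.lam_pos)
  have h2 : 0 ≤ Real.sinh (√(p.φ / p.lam) * t) := Real.sinh_nonneg_iff.2 (mul_nonneg h.le ht)
  have h3 := mul_pos (div_pos p.varrho_pos p.lam_pos)
    (mul_pos h (Real.cosh_pos (√(p.φ / p.lam) * t)))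
  have h4 := mul_nonneg h.le (mul_nonneg h.le h2)
  rw [deriv_R]; dsimp only; linarith

/-- The deterministic rate `R'(T-t) / R(T)`, at which an agent liquidates a unit of excess
inventory. -/
noncomputable def unitRate (p : Params) (t : ℝ) : ℝ := deriv (R p) (p.T - t) / R p p.T

theorem continuous_unitRate (p : Params) : Continuous (unitRate p) :=
  ((continuous_deriv_R p).comp (continuous_const.sub continuous_id)).div_const _

theorem hasDerivAt_unitInventory (p : Params) (t : ℝ) :
    HasDerivAt (fun t => R p (p.T - t) / R p p.T) (-unitRate p t) t := by
  have h1 : HasDerivAt (fun t : ℝ => p.T - t) (-1) t := by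
    simpa using (hasDerivAt_id t).const_sub p.T
  have := ((hasDerivAt_R p (p.T - t)).comp t h1).div_const (R p p.T)
  refine this.congr_deriv ?_
  rw [unitRate, deriv_R]; ring

/-- Identifies `R(T-t)/R(T)` as the inventory left from one unit that is sold at the rate
`unitRate`. -/
theorem integral_unitRate (p : Params) (t : ℝ) :
    ∫ s in (0 : ℝ)..t, unitRate p s = 1 - R p (p.T - t) / R p p.T := by
  have := intervalIntegral.integral_eq_sub_of_hasDerivAt (a := 0) (b := t)
    (fun s _ => hasDerivAt_unitInventory p s)
    ((continuous_unitRate p).neg.intervalIntegrable _ _)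
  rw [intervalIntegral.integral_neg, sub_zero, div_self (R_pos p p.T_pos.le).ne'] at this
  linarith

/-- The deterministic liquidation of a unit of inventory is critical for the deterministic
liquidation problem. -/
theorem unitRate_critical (p : Params) {w : ℝ → ℝ} (hw : IntervalIntegrable w volume 0 p.T) :
    p.lam * (∫ t in (0 : ℝ)..p.T, unitRate p t * w t)
      = p.φ * (∫ t in (0 : ℝ)..p.T, R p (p.T - t) / R p p.T * ∫ s in (0 : ℝ)..t, w s)
        + p.varrho * (R p 0 / R p p.T * ∫ t in (0 : ℝ)..p.T, w t) := by
  have hd : ∀ t, HasDerivAt (unitRate p) (-(p.φ / p.lam * (R p (p.T - t) / R p p.T))) t := by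
    intro t
    have h1 : HasDerivAt (fun t : ℝ => p.T - t) (-1) t := by
      simpa using (hasDerivAt_id t).const_sub p.T
    refine (((hasDerivAt_deriv_R p (p.T - t)).comp t h1).div_const (R p p.T)).congr_deriv ?_
    ring
  have hc : Continuous fun t => -(p.φ / p.lam * (R p (p.T - t) / R p p.T)) :=
    (continuous_const.mul
      (((continuous_R p).comp (continuous_const.sub continuous_id)).div_const _)).neg
  have key := integral_mul_primitive_of_hasDerivAt hd hc hw 0
  have e : ∀ t, -(p.φ / p.lam * (R p (p.T - t) / R p p.T)) * (0 + ∫ s in (0 : ℝ)..t, w s)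
      = -(p.φ / p.lam) * (R p (p.T - t) / R p p.T * ∫ s in (0 : ℝ)..t, w s) := fun t => by ring
  simp only [e, intervalIntegral.integral_const_mul] at key
  -- The boundary condition `R'(0) = (ϱ/λ)R(0)`, which encodes the terminal penalty.
  have hT : unitRate p p.T = p.varrho / p.lam * (R p 0 / R p p.T) := by
    rw [unitRate, deriv_R, R.eq_def p 0]; simp; ring
  rw [hT] at key
  have h1 : p.lam * (p.φ / p.lam) = p.φ := mul_div_cancel₀ _ p.lam_pos.ne'
  have h2 : p.lam * (p.varrho / p.lam) = p.varrho := mul_div_cancel₀ _ p.lam_pos.ne'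
  linear_combination p.lam * key
    + (∫ t in (0 : ℝ)..p.T, R p (p.T - t) / R p p.T * ∫ s in (0 : ℝ)..t, w s) * h1
    + (R p 0 / R p p.T * ∫ t in (0 : ℝ)..p.T, w t) * h2

/-- Positivity of the exponential kernel. -/
theorem integral_exp_kernel_nonneg {T ρ : ℝ} (hT : 0 ≤ T) (hρ : 0 ≤ ρ) {w : ℝ → ℝ}
    (hw : IntervalIntegrable w volume 0 T) :
    0 ≤ ∫ t in (0 : ℝ)..T, (∫ s in (0 : ℝ)..t, Real.exp (-ρ * (t - s)) * w s) * w t := by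
  -- With `u = e^{ρs}w` and `U = ∫u` the integrand is `e^{-2ρt}Uu = e^{-2ρt}(U²/2)'`. Integration by
  -- parts yields `e^{-2ρT}U(T)²/2 + ρ∫e^{-2ρt}U²`, both terms nonnegative.
  set u : ℝ → ℝ := fun s => Real.exp (ρ * s) * w s with hu
  have hui : IntervalIntegrable u volume 0 T :=
    hw.continuousOn_mul (by fun_prop)
  set U : ℝ → ℝ := fun t => ∫ s in (0 : ℝ)..t, u s with hU
  have hUc : ContinuousOn U (Set.uIcc 0 T) := continuousOn_primitive_of_intervalIntegrable hui
  have hUu : IntervalIntegrable (fun t => U t * u t) volume 0 T := hui.continuousOn_mul hUc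
  have sq : ∀ t ∈ Set.Icc 0 T, ∫ s in (0 : ℝ)..t, U s * u s = U t ^ 2 / 2 := by
    intro t ht
    have hut : IntervalIntegrable u volume 0 t :=
      hui.mono_set (by rw [Set.uIcc_of_le hT, Set.uIcc_of_le ht.1]; exact Set.Icc_subset_Icc_right ht.2)
    have := integral_add_mul_primitive 0 0 hut hut
    simp only [zero_add, mul_zero, sub_zero] at this
    have e : ∀ s, u s * (∫ r in (0 : ℝ)..s, u r) = (∫ r in (0 : ℝ)..s, u r) * u s :=
      fun s => mul_comm _ _
    simp only [e] at this
    simp only [hU]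
    linarith
  have hd : ∀ t, HasDerivAt (fun t => Real.exp (-(2 * ρ) * t))
      (-(2 * ρ) * Real.exp (-(2 * ρ) * t)) t := by
    intro t
    have h1 : HasDerivAt (fun t : ℝ => -(2 * ρ) * t) (-(2 * ρ)) t := by
      simpa using (hasDerivAt_id t).const_mul (-(2 * ρ))
    exact h1.exp.congr_deriv (by ring)
  have key := integral_mul_primitive_of_hasDerivAt hd (by fun_prop) hUu 0
  have e1 : ∫ t in (0 : ℝ)..T, (∫ s in (0 : ℝ)..t, Real.exp (-ρ * (t - s)) * w s) * w t
      = ∫ t in (0 : ℝ)..T, Real.exp (-(2 * ρ) * t) * (U t * u t) := by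
    refine intervalIntegral.integral_congr fun t _ => ?_
    have : ∀ s, Real.exp (-ρ * (t - s)) * w s = Real.exp (-ρ * t) * u s := fun s => by
      rw [hu]; dsimp only
      rw [← mul_assoc, ← Real.exp_add]; ring_nf
    simp only [this, intervalIntegral.integral_const_mul]
    have e3 : Real.exp (-(2 * ρ) * t) * Real.exp (ρ * t) = Real.exp (-ρ * t) := by
      rw [← Real.exp_add]; ring_nf
    simp only [hU]
    rw [← e3, hu]; ring
  rw [e1]
  have e2 : ∫ t in (0 : ℝ)..T, -(2 * ρ) * Real.exp (-(2 * ρ) * t)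
        * (0 + ∫ s in (0 : ℝ)..t, U s * u s) ≤ 0 := by
    rw [← neg_nonneg, ← intervalIntegral.integral_neg]
    refine intervalIntegral.integral_nonneg hT fun t ht => ?_
    rw [zero_add, sq t ht]
    have := Real.exp_pos (-(2 * ρ) * t)
    rw [show -(-(2 * ρ) * Real.exp (-(2 * ρ) * t) * (U t ^ 2 / 2))
      = ρ * Real.exp (-(2 * ρ) * t) * U t ^ 2 by ring]
    positivity
  rw [sq T ⟨hT, le_rfl⟩] at key
  have := Real.exp_pos (-(2 * ρ) * T)
  have h3 : 0 ≤ Real.exp (-(2 * ρ) * T) * (0 + U T ^ 2 / 2) := by positivity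
  linarith

/-- Variation of constants for `Y' = -ρ Y + γ n`. -/
theorem eq_exp_of_integral_eq {T ρ γ y : ℝ} {Y n : ℝ → ℝ}
    (hY : ContinuousOn Y (Set.Icc 0 T)) (hn : IntervalIntegrable n volume 0 T)
    (h : ∀ t ∈ Set.Icc 0 T, Y t = y + ∫ s in (0 : ℝ)..t, (-ρ * Y s + γ * n s))
    {t : ℝ} (ht : t ∈ Set.Icc 0 T) :
    Y t = Real.exp (-ρ * t) * y + γ * ∫ s in (0 : ℝ)..t, Real.exp (-ρ * (t - s)) * n s := by
  have hT : 0 ≤ T := ht.1.trans ht.2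
  have sub : Set.uIcc 0 t ⊆ Set.uIcc 0 T := by
    rw [Set.uIcc_of_le hT, Set.uIcc_of_le ht.1]; exact Set.Icc_subset_Icc_right ht.2
  have hn' := hn.mono_set sub
  have hY' : ContinuousOn Y (Set.uIcc 0 t) := hY.mono (by rwa [← Set.uIcc_of_le hT])
  have hg : IntervalIntegrable (fun s => -ρ * Y s + γ * n s) volume 0 t :=
    (hY'.intervalIntegrable.const_mul _).add (hn'.const_mul _)
  have hd : ∀ t, HasDerivAt (fun t => Real.exp (ρ * t)) (ρ * Real.exp (ρ * t)) t := by
    intro t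
    have h1 : HasDerivAt (fun t : ℝ => ρ * t) ρ t := by
      simpa using (hasDerivAt_id t).const_mul ρ
    exact h1.exp.congr_deriv (by ring)
  -- The integrating factor `e^{ρt}`, applied through integration by parts because `n` is merely
  -- integrable and the equation holds only in integral form.
  have key := integral_mul_primitive_of_hasDerivAt hd (by fun_prop) hg y
  rw [← h t ht] at key
  have e1 : ∫ s in (0 : ℝ)..t, ρ * Real.exp (ρ * s)
        * (y + ∫ r in (0 : ℝ)..s, (-ρ * Y r + γ * n r))
      = ∫ s in (0 : ℝ)..t, ρ * Real.exp (ρ * s) * Y s := by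
    refine intervalIntegral.integral_congr fun s hs => ?_
    rw [Set.uIcc_of_le ht.1] at hs
    simp only [← h s ⟨hs.1, hs.2.trans ht.2⟩]
  have e2 : ∫ s in (0 : ℝ)..t, Real.exp (ρ * s) * (-ρ * Y s + γ * n s)
      = -(∫ s in (0 : ℝ)..t, ρ * Real.exp (ρ * s) * Y s)
        + γ * ∫ s in (0 : ℝ)..t, Real.exp (ρ * s) * n s := by
    rw [← intervalIntegral.integral_neg, ← intervalIntegral.integral_const_mul,
      ← intervalIntegral.integral_add]
    · refine intervalIntegral.integral_congr fun s _ => ?_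
      ring
    · exact (hY'.intervalIntegrable.continuousOn_mul
        (g := fun s => ρ * Real.exp (ρ * s)) (by fun_prop)).neg
    · exact (hn'.continuousOn_mul (g := fun s => Real.exp (ρ * s)) (by fun_prop)).const_mul _
  rw [e1, e2] at key
  simp only [mul_zero, Real.exp_zero, one_mul] at key
  have e3 : ∫ s in (0 : ℝ)..t, Real.exp (-ρ * (t - s)) * n s
      = Real.exp (-ρ * t) * ∫ s in (0 : ℝ)..t, Real.exp (ρ * s) * n s := by
    rw [← intervalIntegral.integral_const_mul]
    refine intervalIntegral.integral_congr fun s _ => ?_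
    rw [← mul_assoc, ← Real.exp_add]; ring_nf
  have e4 : Real.exp (-ρ * t) * Real.exp (ρ * t) = 1 := by
    rw [← Real.exp_add]; simp
  rw [e3]
  linear_combination -Real.exp (-ρ * t) * key - Y t * e4
end LiquidationGame

/-! ### The payoff of an agent along one fixed path -/

namespace LiquidationGame

/-- Square-integrable functions on `[0,T]`. -/
def PathL2 (T : ℝ) (f : ℝ → ℝ) : Prop := MemLp f 2 (volume.restrict (Set.Icc 0 T))

namespace PathL2

variable {T : ℝ} {f g : ℝ → ℝ}

theorem add (hf : PathL2 T f) (hg : PathL2 T g) : PathL2 T (fun t => f t + g t) :=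
  MemLp.add hf hg

theorem sub (hf : PathL2 T f) (hg : PathL2 T g) : PathL2 T (fun t => f t - g t) :=
  MemLp.sub hf hg

theorem const_mul (hf : PathL2 T f) (c : ℝ) : PathL2 T (fun t => c * f t) :=
  MemLp.const_mul hf c

theorem congr (hf : PathL2 T f) (h : ∀ t ∈ Set.Icc 0 T, f t = g t) : PathL2 T g :=
  MemLp.ae_eq (by
    filter_upwards [ae_restrict_mem measurableSet_Icc] with t ht using h t ht) hf

theorem of_continuousOn (hf : ContinuousOn f (Set.Icc 0 T)) : PathL2 T f := by
  obtain ⟨C, hC⟩ := isCompact_Icc.exists_bound_of_continuousOn hf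
  refine MemLp.of_bound (hf.aestronglyMeasurable measurableSet_Icc) C ?_
  filter_upwards [ae_restrict_mem measurableSet_Icc] with t ht using hC t ht

theorem intervalIntegrable (hT : 0 ≤ T) (hf : PathL2 T f) : IntervalIntegrable f volume 0 T := by
  rw [intervalIntegrable_iff_integrableOn_Icc_of_le hT]
  exact MemLp.integrable one_le_two hf

theorem mul (hT : 0 ≤ T) (hf : PathL2 T f) (hg : PathL2 T g) :
    IntervalIntegrable (fun t => f t * g t) volume 0 T := by
  rw [intervalIntegrable_iff_integrableOn_Icc_of_le hT]
  exact MemLp.integrable_mul hf hg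

theorem sq (hT : 0 ≤ T) (hf : PathL2 T f) :
    IntervalIntegrable (fun t => f t ^ 2) volume 0 T := by
  simpa only [pow_two] using hf.mul hT hf

theorem intervalIntegrable_sub (hT : 0 ≤ T) (hf : PathL2 T f) {t : ℝ} (ht : t ∈ Set.Icc 0 T) :
    IntervalIntegrable f volume 0 t :=
  (hf.intervalIntegrable hT).mono_set (by
    rw [Set.uIcc_of_le hT, Set.uIcc_of_le ht.1]; exact Set.Icc_subset_Icc_right ht.2)

theorem continuousOn_primitive (hT : 0 ≤ T) (hf : PathL2 T f) :
    ContinuousOn (fun t => ∫ s in (0 : ℝ)..t, f s) (Set.Icc 0 T) := by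
  rw [← Set.uIcc_of_le hT]
  exact continuousOn_primitive_of_intervalIntegrable (hf.intervalIntegrable hT)

theorem primitive (hT : 0 ≤ T) (hf : PathL2 T f) :
    PathL2 T (fun t => ∫ s in (0 : ℝ)..t, f s) :=
  of_continuousOn (hf.continuousOn_primitive hT)

end PathL2

/-- The payoff of an agent on a single path. -/
noncomputable def pathPayoff (p : Params) (S : ℝ → ℝ) (PT x : ℝ) (w : ℝ → ℝ) : ℝ :=
  (∫ t in (0 : ℝ)..p.T, S t * w t) - p.lam * (∫ t in (0 : ℝ)..p.T, w t ^ 2)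
    - p.φ * (∫ t in (0 : ℝ)..p.T, (x - ∫ s in (0 : ℝ)..t, w s) ^ 2)
    + (x - ∫ s in (0 : ℝ)..p.T, w s) * (PT - p.varrho * (x - ∫ s in (0 : ℝ)..p.T, w s))

/-- The bilinear form of the quadratic costs on a single path. -/
noncomputable def pathEnergy (p : Params) (u w : ℝ → ℝ) : ℝ :=
  p.lam * (∫ t in (0 : ℝ)..p.T, u t * w t)
    + p.φ * (∫ t in (0 : ℝ)..p.T, (∫ s in (0 : ℝ)..t, u s) * (∫ s in (0 : ℝ)..t, w s))
    + p.varrho * ((∫ t in (0 : ℝ)..p.T, u t) * (∫ t in (0 : ℝ)..p.T, w t))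

/-- The derivative of the payoff on a single path. -/
noncomputable def pathGradient (p : Params) (S : ℝ → ℝ) (PT x : ℝ) (v w : ℝ → ℝ) : ℝ :=
  (∫ t in (0 : ℝ)..p.T, S t * w t) - 2 * p.lam * (∫ t in (0 : ℝ)..p.T, v t * w t)
    + 2 * p.φ * (∫ t in (0 : ℝ)..p.T,
        (x - ∫ s in (0 : ℝ)..t, v s) * (∫ s in (0 : ℝ)..t, w s))
    - (∫ s in (0 : ℝ)..p.T, w s) * (PT - 2 * p.varrho * (x - ∫ s in (0 : ℝ)..p.T, v s))

/-- Coercivity: the inventory terms are nonnegative squares and can be dropped. Hence zero energy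
forces a zero rate. -/
theorem lam_mul_integral_sq_le_pathEnergy (p : Params) (w : ℝ → ℝ) :
    p.lam * (∫ t in (0 : ℝ)..p.T, w t ^ 2) ≤ pathEnergy p w w := by
  have h1 : 0 ≤ ∫ t in (0 : ℝ)..p.T, (∫ s in (0 : ℝ)..t, w s) * (∫ s in (0 : ℝ)..t, w s) :=
    intervalIntegral.integral_nonneg p.T_pos.le fun t _ => mul_self_nonneg _
  have h2 := mul_nonneg p.φ_pos.le h1
  have h3 := mul_nonneg p.varrho_pos.le (mul_self_nonneg (∫ t in (0 : ℝ)..p.T, w t))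
  simp only [pathEnergy, pow_two]
  linarith

theorem integral_sq_nonneg (p : Params) (w : ℝ → ℝ) : 0 ≤ ∫ t in (0 : ℝ)..p.T, w t ^ 2 :=
  intervalIntegral.integral_nonneg p.T_pos.le fun _ _ => sq_nonneg _

theorem pathEnergy_self_nonneg (p : Params) (w : ℝ → ℝ) : 0 ≤ pathEnergy p w w :=
  (mul_nonneg p.lam_pos.le (integral_sq_nonneg p w)).trans (lam_mul_integral_sq_le_pathEnergy p w)

theorem integral_congr_Icc {T : ℝ} (hT : 0 ≤ T) {f g : ℝ → ℝ}
    (h : ∀ t ∈ Set.Icc 0 T, f t = g t) :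
    ∫ t in (0 : ℝ)..T, f t = ∫ t in (0 : ℝ)..T, g t :=
  intervalIntegral.integral_congr fun t ht => h t (by rwa [Set.uIcc_of_le hT] at ht)

/-- The payoff is quadratic in the rate, so its second order expansion is exact and no
differentiation under the expectation is needed. -/
theorem pathPayoff_add (p : Params) {S v w : ℝ → ℝ} (PT x ε : ℝ)
    (hS : PathL2 p.T S) (hv : PathL2 p.T v) (hw : PathL2 p.T w) :
    pathPayoff p S PT x (fun t => v t + ε * w t)
      = pathPayoff p S PT x v + ε * pathGradient p S PT x v w - ε ^ 2 * pathEnergy p w w := by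
  have hT := p.T_pos.le
  have hV : ∀ t ∈ Set.Icc 0 p.T, ∫ s in (0 : ℝ)..t, (v s + ε * w s)
      = (∫ s in (0 : ℝ)..t, v s) + ε * ∫ s in (0 : ℝ)..t, w s := fun t ht => by
    rw [intervalIntegral.integral_add (hv.intervalIntegrable_sub hT ht)
      ((hw.intervalIntegrable_sub hT ht).const_mul ε), intervalIntegral.integral_const_mul]
  have hX : PathL2 p.T (fun t => x - ∫ s in (0 : ℝ)..t, v s) :=
    (PathL2.of_continuousOn continuousOn_const).sub (hv.primitive hT)
  have hW := hw.primitive hT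
  have e1 : ∫ t in (0 : ℝ)..p.T, S t * (v t + ε * w t)
      = (∫ t in (0 : ℝ)..p.T, S t * v t) + ε * ∫ t in (0 : ℝ)..p.T, S t * w t := by
    rw [← intervalIntegral.integral_const_mul,
      ← intervalIntegral.integral_add (hS.mul hT hv) ((hS.mul hT hw).const_mul ε)]
    exact integral_congr_Icc hT fun t _ => by ring
  have e2 : ∫ t in (0 : ℝ)..p.T, (v t + ε * w t) ^ 2
      = (∫ t in (0 : ℝ)..p.T, v t ^ 2) + 2 * ε * (∫ t in (0 : ℝ)..p.T, v t * w t)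
        + ε ^ 2 * ∫ t in (0 : ℝ)..p.T, w t * w t := by
    rw [← intervalIntegral.integral_const_mul, ← intervalIntegral.integral_const_mul,
      ← intervalIntegral.integral_add (hv.sq hT) ((hv.mul hT hw).const_mul _),
      ← intervalIntegral.integral_add ((hv.sq hT).add ((hv.mul hT hw).const_mul _))
        ((hw.mul hT hw).const_mul _)]
    exact integral_congr_Icc hT fun t _ => by ring
  have e3 : ∫ t in (0 : ℝ)..p.T, (x - ∫ s in (0 : ℝ)..t, (v s + ε * w s)) ^ 2
      = (∫ t in (0 : ℝ)..p.T, (x - ∫ s in (0 : ℝ)..t, v s) ^ 2)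
        + (-2 * ε) * (∫ t in (0 : ℝ)..p.T,
            (x - ∫ s in (0 : ℝ)..t, v s) * (∫ s in (0 : ℝ)..t, w s))
        + ε ^ 2 * ∫ t in (0 : ℝ)..p.T, (∫ s in (0 : ℝ)..t, w s) * (∫ s in (0 : ℝ)..t, w s) := by
    rw [← intervalIntegral.integral_const_mul, ← intervalIntegral.integral_const_mul,
      ← intervalIntegral.integral_add (hX.sq hT) ((hX.mul hT hW).const_mul _),
      ← intervalIntegral.integral_add ((hX.sq hT).add ((hX.mul hT hW).const_mul _))
        ((hW.mul hT hW).const_mul _)]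
    refine integral_congr_Icc hT fun t ht => ?_
    rw [hV t ht]; ring
  simp only [pathPayoff, pathGradient, pathEnergy]
  rw [e1, e2, e3, hV p.T ⟨hT, le_rfl⟩]
  ring

/-- The gradient of the payoff, when the price is expressed through the mean field solution `n`
and a martingale term `z`, and the rate is `n + a R'(T-t)/R(T) + ζ`. -/
theorem pathGradient_eq (p : Params) {S n z d ζ w v : ℝ → ℝ} (PT xbar a : ℝ)
    (hn : PathL2 p.T n) (hz : PathL2 p.T z) (hd : PathL2 p.T d) (hζ : PathL2 p.T ζ)
    (hw : PathL2 p.T w)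
    (hv : ∀ t ∈ Set.Icc 0 p.T, v t = n t + a * unitRate p t + ζ t)
    (hS : ∀ t ∈ Set.Icc 0 p.T, S t = PT + 2 * p.lam * n t
      - 2 * p.φ * ((∫ s in (0 : ℝ)..p.T, (xbar - ∫ r in (0 : ℝ)..s, n r))
        - ∫ s in (0 : ℝ)..t, (xbar - ∫ r in (0 : ℝ)..s, n r))
      - 2 * p.varrho * (xbar - ∫ r in (0 : ℝ)..p.T, n r)
      + 2 * p.lam * z t - p.κ * d t) :
    pathGradient p S PT (xbar + a) v w
      = 2 * p.lam * (∫ t in (0 : ℝ)..p.T, z t * w t) - 2 * pathEnergy p ζ w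
        - p.κ * ∫ t in (0 : ℝ)..p.T, d t * w t := by
  have hT := p.T_pos.le
  have hX : PathL2 p.T (fun t => xbar - ∫ s in (0 : ℝ)..t, n s) :=
    (PathL2.of_continuousOn continuousOn_const).sub (hn.primitive hT)
  have hh : PathL2 p.T (unitRate p) := .of_continuousOn (continuous_unitRate p).continuousOn
  have hr : PathL2 p.T (fun t => R p (p.T - t) / R p p.T) := .of_continuousOn
    (((continuous_R p).comp (continuous_const.sub continuous_id)).div_const _).continuousOn
  set X : ℝ → ℝ := fun t => xbar - ∫ s in (0 : ℝ)..t, n s with hXdef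
  have hW := hw.primitive hT
  have hZ := hζ.primitive hT
  have hXX : PathL2 p.T (fun t => (∫ s in (0 : ℝ)..p.T, X s) - ∫ s in (0 : ℝ)..t, X s) :=
    (PathL2.of_continuousOn continuousOn_const).sub (hX.primitive hT)
  have hw1 := hw.intervalIntegrable hT
  have eX : ∀ t ∈ Set.Icc 0 p.T, xbar + a - ∫ s in (0 : ℝ)..t, v s
      = X t + a * (R p (p.T - t) / R p p.T) - ∫ s in (0 : ℝ)..t, ζ s := fun t ht => by
    have : ∫ s in (0 : ℝ)..t, v s = ∫ s in (0 : ℝ)..t, (n s + a * unitRate p s + ζ s) :=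
      integral_congr_Icc ht.1 fun s hs => hv s ⟨hs.1, hs.2.trans ht.2⟩
    rw [this, intervalIntegral.integral_add ((hn.intervalIntegrable_sub hT ht).add
        ((hh.intervalIntegrable_sub hT ht).const_mul a)) (hζ.intervalIntegrable_sub hT ht),
      intervalIntegral.integral_add (hn.intervalIntegrable_sub hT ht)
        ((hh.intervalIntegrable_sub hT ht).const_mul a),
      intervalIntegral.integral_const_mul, integral_unitRate]
    simp only [hXdef]; ring
  have e1 : (∫ t in (0 : ℝ)..p.T, S t * w t) = (PT - 2 * p.varrho * X p.T)
        * (∫ t in (0 : ℝ)..p.T, w t)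
      + 2 * p.lam * (∫ t in (0 : ℝ)..p.T, n t * w t)
      - 2 * p.φ * (∫ t in (0 : ℝ)..p.T,
          ((∫ s in (0 : ℝ)..p.T, X s) - ∫ s in (0 : ℝ)..t, X s) * w t)
      + 2 * p.lam * (∫ t in (0 : ℝ)..p.T, z t * w t)
      - p.κ * ∫ t in (0 : ℝ)..p.T, d t * w t := by
    simp only [← intervalIntegral.integral_const_mul]
    have i1 := hw1.const_mul (PT - 2 * p.varrho * X p.T)
    have i2 := (hn.mul hT hw).const_mul (2 * p.lam)
    have i3 := (hXX.mul hT hw).const_mul (2 * p.φ)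
    have i4 := (hz.mul hT hw).const_mul (2 * p.lam)
    have i5 := (hd.mul hT hw).const_mul p.κ
    rw [← intervalIntegral.integral_add i1 i2, ← intervalIntegral.integral_sub (i1.add i2) i3,
      ← intervalIntegral.integral_add ((i1.add i2).sub i3) i4,
      ← intervalIntegral.integral_sub (((i1.add i2).sub i3).add i4) i5]
    refine integral_congr_Icc hT fun t ht => ?_
    rw [hS t ht]; ring
  have e2 : (∫ t in (0 : ℝ)..p.T, v t * w t) = (∫ t in (0 : ℝ)..p.T, n t * w t)
      + a * (∫ t in (0 : ℝ)..p.T, unitRate p t * w t) + ∫ t in (0 : ℝ)..p.T, ζ t * w t := by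
    rw [← intervalIntegral.integral_const_mul]
    have i1 := hn.mul hT hw
    have i2 := (hh.mul hT hw).const_mul a
    rw [← intervalIntegral.integral_add i1 i2,
      ← intervalIntegral.integral_add (i1.add i2) (hζ.mul hT hw)]
    refine integral_congr_Icc hT fun t ht => ?_
    rw [hv t ht]; ring
  have e3 : (∫ t in (0 : ℝ)..p.T,
        (xbar + a - ∫ s in (0 : ℝ)..t, v s) * (∫ s in (0 : ℝ)..t, w s))
      = (∫ t in (0 : ℝ)..p.T, X t * ∫ s in (0 : ℝ)..t, w s)
        + a * (∫ t in (0 : ℝ)..p.T, R p (p.T - t) / R p p.T * ∫ s in (0 : ℝ)..t, w s)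
        - ∫ t in (0 : ℝ)..p.T, (∫ s in (0 : ℝ)..t, ζ s) * (∫ s in (0 : ℝ)..t, w s) := by
    rw [← intervalIntegral.integral_const_mul]
    have i1 := hX.mul hT hW
    have i2 := (hr.mul hT hW).const_mul a
    rw [← intervalIntegral.integral_add i1 i2,
      ← intervalIntegral.integral_sub (i1.add i2) (hZ.mul hT hW)]
    refine integral_congr_Icc hT fun t ht => ?_
    rw [eX t ht]; ring
  -- After the swap the `φ`-terms involving `X` cancel, as do the `n`, `PT` and terminal terms. The
  -- terms carrying `a` cancel by `unitRate_critical`, leaving only `z`, `ζ` and `d`.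
  have e4 := integral_mul_primitive_swap (hX.intervalIntegrable hT) hw1
  have e5 := unitRate_critical p hw1
  have e6 := eX p.T ⟨hT, le_rfl⟩
  rw [sub_self] at e6
  simp only [pathGradient, pathEnergy]
  rw [e1, e2, e3, e6, e4]
  linear_combination -2 * a * e5

end LiquidationGame

/-! ### Square integrability and joint measurability on `Ω × [0,T]` -/

namespace LiquidationGame

variable {Ω : Type*} {mΩ : MeasurableSpace Ω}

/-- Processes that are square-integrable with respect to `dℙ ⊗ dt`. -/
def FlowL2 (T : ℝ) (μ : Measure Ω) (f : ℝ → Ω → ℝ) : Prop :=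
  MemLp (fun q : Ω × ℝ => f q.2 q.1) 2 (timeMeasure T μ)

section Basic

variable {μ : Measure Ω} [IsProbabilityMeasure μ] {T : ℝ} {f g : ℝ → Ω → ℝ}

instance : IsFiniteMeasure (timeMeasure T μ) := by
  unfold timeMeasure; infer_instance

theorem integral_Icc_eq_interval (hT : 0 ≤ T) (h : ℝ → ℝ) :
    ∫ t in Set.Icc 0 T, h t = ∫ t in (0 : ℝ)..T, h t := by
  rw [intervalIntegral.integral_of_le hT, integral_Icc_eq_integral_Ioc]

theorem ae_timeMeasure_of_ae {q : Ω → Prop} (h : ∀ᵐ ω ∂μ, q ω) :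
    ∀ᵐ z ∂(timeMeasure T μ), q z.1 ∧ z.2 ∈ Set.Icc 0 T := by
  have h1 : ∀ᵐ z ∂(timeMeasure T μ), q z.1 := Measure.quasiMeasurePreserving_fst.ae h
  have h2 : ∀ᵐ z ∂(timeMeasure T μ), z.2 ∈ Set.Icc 0 T :=
    Measure.quasiMeasurePreserving_snd.ae (ae_restrict_mem measurableSet_Icc)
  filter_upwards [h1, h2] with z a b using ⟨a, b⟩

theorem ae_ae_of_ae_timeMeasure {q : Ω → ℝ → Prop}
    (h : ∀ᵐ z ∂(timeMeasure T μ), q z.1 z.2) :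
    ∀ᵐ ω ∂μ, ∀ᵐ t ∂(volume.restrict (Set.Icc 0 T)), q ω t :=
  Measure.ae_ae_of_ae_prod h

namespace FlowL2

theorem add (hf : FlowL2 T μ f) (hg : FlowL2 T μ g) : FlowL2 T μ (fun t ω => f t ω + g t ω) :=
  MemLp.add hf hg

theorem sub (hf : FlowL2 T μ f) (hg : FlowL2 T μ g) : FlowL2 T μ (fun t ω => f t ω - g t ω) :=
  MemLp.sub hf hg

theorem const_mul (hf : FlowL2 T μ f) (c : ℝ) : FlowL2 T μ (fun t ω => c * f t ω) :=
  MemLp.const_mul hf c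

theorem congr (hf : FlowL2 T μ f) (h : ∀ᵐ ω ∂μ, ∀ t ∈ Set.Icc 0 T, f t ω = g t ω) :
    FlowL2 T μ g :=
  MemLp.ae_eq (by filter_upwards [ae_timeMeasure_of_ae h] with z hz using hz.1 _ hz.2) hf

theorem of_memLp {h : Ω → ℝ} (hh : MemLp h 2 μ) : FlowL2 T μ (fun _ ω => h ω) :=
  MemLp.comp_fst hh _

theorem of_continuous {h : ℝ → ℝ} (hh : Continuous h) : FlowL2 T μ (fun t _ => h t) :=
  MemLp.comp_snd (f := h) (PathL2.of_continuousOn hh.continuousOn) μ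

theorem continuous_mul {h : ℝ → ℝ} (hh : Continuous h) (hf : FlowL2 T μ f) :
    FlowL2 T μ (fun t ω => h t * f t ω) := by
  obtain ⟨C, hC⟩ := (isCompact_Icc (a := 0) (b := T)).exists_bound_of_continuousOn hh.continuousOn
  refine MemLp.of_le_mul (c := C) hf
    ((hh.measurable.comp measurable_snd).aestronglyMeasurable.mul hf.1) ?_
  filter_upwards [ae_timeMeasure_of_ae (μ := μ) (T := T) (q := fun _ => True) (by simp)] with z hz
  rw [norm_mul]
  exact mul_le_mul_of_nonneg_right (hC _ hz.2) (norm_nonneg _)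

theorem ae_pathL2 (hf : FlowL2 T μ f) : ∀ᵐ ω ∂μ, PathL2 T (fun t => f t ω) := by
  have h2 : Integrable (fun q : Ω × ℝ => f q.2 q.1 ^ 2) (timeMeasure T μ) := hf.integrable_sq
  have h1 : ∀ᵐ ω ∂μ, AEStronglyMeasurable (fun t => f t ω) (volume.restrict (Set.Icc 0 T)) :=
    AEStronglyMeasurable.prodMk_left hf.1
  filter_upwards [h1, h2.prod_right_ae] with ω a b
  exact (memLp_two_iff_integrable_sq a).2 b

theorem integrable_integral (hT : 0 ≤ T) (hf : FlowL2 T μ f) :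
    Integrable (fun ω => ∫ t in (0 : ℝ)..T, f t ω) μ := by
  simp only [← integral_Icc_eq_interval hT]
  exact (MemLp.integrable one_le_two hf).integral_prod_left

theorem integrable_integral_mul (hT : 0 ≤ T) (hf : FlowL2 T μ f) (hg : FlowL2 T μ g) :
    Integrable (fun ω => ∫ t in (0 : ℝ)..T, f t ω * g t ω) μ := by
  simp only [← integral_Icc_eq_interval hT]
  exact (MemLp.integrable_mul hf hg : Integrable (fun q : Ω × ℝ => f q.2 q.1 * g q.2 q.1)
    (μ.prod (volume.restrict (Set.Icc 0 T)))).integral_prod_left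

theorem integrable_integral_sq (hT : 0 ≤ T) (hf : FlowL2 T μ f) :
    Integrable (fun ω => ∫ t in (0 : ℝ)..T, f t ω ^ 2) μ := by
  simpa only [pow_two] using hf.integrable_integral_mul hT hf

/-- Cauchy–Schwarz, from integrating the square of `|h|` minus its mean. -/
theorem sq_integral_le {h : ℝ → ℝ} (hT : 0 < T) (hh : PathL2 T h) :
    (∫ t in (0 : ℝ)..T, |h t|) ^ 2 ≤ T * ∫ t in (0 : ℝ)..T, h t ^ 2 := by
  set N := ∫ t in (0 : ℝ)..T, |h t| with hN
  have i0 : IntervalIntegrable (fun t => |h t|) volume 0 T := (hh.intervalIntegrable hT.le).norm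
  have i1 := hh.sq hT.le
  have i2 := i0.const_mul (2 * N / T)
  have i3 : IntervalIntegrable (fun _ : ℝ => (N / T) ^ 2) volume 0 T := intervalIntegrable_const
  have h0 : 0 ≤ ∫ t in (0 : ℝ)..T, (|h t| - N / T) ^ 2 :=
    intervalIntegral.integral_nonneg hT.le fun _ _ => sq_nonneg _
  have e : ∫ t in (0 : ℝ)..T, (|h t| - N / T) ^ 2
      = (∫ t in (0 : ℝ)..T, h t ^ 2) - 2 * N / T * N + T * (N / T) ^ 2 := by
    have : ∀ t, (|h t| - N / T) ^ 2 = h t ^ 2 - 2 * N / T * |h t| + (N / T) ^ 2 := fun t => by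
      rw [sub_sq, sq_abs]; ring
    simp only [this]
    rw [intervalIntegral.integral_add (i1.sub i2) i3, intervalIntegral.integral_sub i1 i2,
      intervalIntegral.integral_const_mul, intervalIntegral.integral_const, ← hN]
    simp
  rw [e] at h0
  have h1 := mul_nonneg hT.le h0
  have h2 : T * ((∫ t in (0 : ℝ)..T, h t ^ 2) - 2 * N / T * N + T * (N / T) ^ 2)
      = T * (∫ t in (0 : ℝ)..T, h t ^ 2) - N ^ 2 := by
    field_simp; ring
  linarith

theorem memLp_integral_abs (hT : 0 < T) (hf : FlowL2 T μ f) :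
    MemLp (fun ω => ∫ t in (0 : ℝ)..T, |f t ω|) 2 μ := by
  have h1 : FlowL2 T μ (fun t ω => |f t ω|) := MemLp.norm hf
  have h2 := (h1.integrable_integral hT.le).aestronglyMeasurable
  refine (memLp_two_iff_integrable_sq h2).2 ?_
  refine ((hf.integrable_integral_sq hT.le).const_mul T).mono' (h2.pow 2) ?_
  filter_upwards [hf.ae_pathL2] with ω hω
  rw [Real.norm_of_nonneg (sq_nonneg _)]
  exact sq_integral_le hT hω

theorem abs_primitive_le {h : ℝ → ℝ} (hT : 0 ≤ T) (hh : PathL2 T h) {t : ℝ}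
    (ht : t ∈ Set.Icc 0 T) : |∫ s in (0 : ℝ)..t, h s| ≤ ∫ s in (0 : ℝ)..T, |h s| := by
  refine (intervalIntegral.abs_integral_le_integral_abs ht.1).trans ?_
  exact intervalIntegral.integral_mono_interval le_rfl ht.1 ht.2 (ae_of_all _ fun _ => abs_nonneg _)
    (hh.intervalIntegrable hT).norm

theorem memLp_integral (hT : 0 < T) (hf : FlowL2 T μ f) :
    MemLp (fun ω => ∫ t in (0 : ℝ)..T, f t ω) 2 μ := by
  refine (hf.memLp_integral_abs hT).of_le (hf.integrable_integral hT.le).aestronglyMeasurable ?_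
  filter_upwards [hf.ae_pathL2] with ω hω
  exact (abs_primitive_le hT.le hω ⟨hT.le, le_rfl⟩).trans (le_abs_self _)

theorem primitive (hT : 0 < T) (hf : FlowL2 T μ f) :
    FlowL2 T μ (fun t ω => ∫ s in (0 : ℝ)..t, f s ω) := by
  have hN : FlowL2 T μ (fun _ ω => ∫ t in (0 : ℝ)..T, |f t ω|) :=
    of_memLp (hf.memLp_integral_abs hT)
  have hb := ae_timeMeasure_of_ae (T := T) hf.ae_pathL2
  refine MemLp.of_le hN ?_ ?_
  · obtain ⟨f', hf', hff'⟩ := hf.1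
    have hae := ae_timeMeasure_of_ae (T := T)
      (ae_ae_of_ae_timeMeasure (q := fun ω t => f t ω = f' (ω, t)) hff')
    -- For a jointly measurable representative `f'`, the primitive is a parameter integral over a
    -- fixed interval with the cutoff `s ≤ t`, hence jointly measurable.
    refine ⟨fun q => ∫ s in Set.Icc 0 T, (if s ≤ q.2 then f' (q.1, s) else 0), ?_, ?_⟩
    · refine StronglyMeasurable.integral_prod_right (ν := volume.restrict (Set.Icc 0 T))
        (f := fun (q : Ω × ℝ) (s : ℝ) => if s ≤ q.2 then f' (q.1, s) else 0) ?_
      refine StronglyMeasurable.ite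
        (measurableSet_le measurable_snd (measurable_snd.comp measurable_fst)) ?_
        stronglyMeasurable_const
      exact hf'.comp_measurable ((measurable_fst.comp measurable_fst).prodMk measurable_snd)
    · filter_upwards [hae] with q hq
      rw [intervalIntegral.integral_of_le hq.2.1, ← integral_Icc_eq_integral_Ioc]
      have : ∫ s in Set.Icc 0 T, (if s ≤ q.2 then f' (q.1, s) else 0)
          = ∫ s in Set.Icc 0 T, (Set.Icc 0 q.2).indicator (fun s => f s q.1) s := by
        refine integral_congr_ae ?_
        filter_upwards [hq.1, ae_restrict_mem measurableSet_Icc] with s hs hs'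
        by_cases h : s ≤ q.2
        · simp [h, hs'.1, hs]
        · simp [h]
      rw [this, integral_indicator measurableSet_Icc, Measure.restrict_restrict measurableSet_Icc,
        Set.inter_eq_left.2 (Set.Icc_subset_Icc_right hq.2.2)]
  · filter_upwards [hb] with q hq
    exact (abs_primitive_le hT.le hq.1 hq.2).trans (le_abs_self _)

theorem distortion (p : Params) (hf : FlowL2 p.T μ f) :
    FlowL2 p.T μ (LiquidationGame.distortion p f) := by
  have h1 : FlowL2 p.T μ (fun t ω => Real.exp (p.ρ * t) * f t ω) :=
    continuous_mul (by fun_prop) hf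
  have h2 : FlowL2 p.T μ (fun t ω => Real.exp (-p.ρ * t) *
      ∫ s in (0 : ℝ)..t, Real.exp (p.ρ * s) * f s ω) :=
    continuous_mul (by fun_prop) (h1.primitive p.T_pos)
  have h3 : FlowL2 p.T μ (fun t _ => Real.exp (-p.ρ * t) * p.y) := of_continuous (by fun_prop)
  refine (h3.add (h2.const_mul p.γ)).congr (ae_of_all _ fun ω t _ => ?_)
  rw [LiquidationGame.distortion, ← intervalIntegral.integral_const_mul]
  congr 2
  refine intervalIntegral.integral_congr fun s _ => ?_
  rw [← mul_assoc, ← Real.exp_add]; ring_nf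

end FlowL2

/-- A progressive process is jointly measurable on `Ω × [0,T]`. -/
theorem aestronglyMeasurable_of_isStronglyProgressive {ℱ : Filtration ℝ≥0 mΩ}
    (hf : IsStronglyProgressive ℱ (stopAt T f)) :
    AEStronglyMeasurable (fun q : Ω × ℝ => f q.2 q.1) (timeMeasure T μ) := by
  -- Clipping time at `T` makes the map factor through `[0,T] × Ω` with the σ-algebra `ℱ_T`, where
  -- progressive measurability applies.
  refine ⟨fun q => stopAt T f (min q.2.toNNReal T.toNNReal) q.1, ?_, ?_⟩
  · have h1 := hf T.toNNReal
    let φ : Ω × ℝ → Set.Iic T.toNNReal × Ω :=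
      fun q => (⟨min q.2.toNNReal T.toNNReal, Set.mem_Iic.2 (min_le_right _ _)⟩, q.1)
    have hφ : @Measurable _ _ _ (Subtype.instMeasurableSpace.prod (ℱ T.toNNReal)) φ := by
      refine @Measurable.of_comap_le _ _ _ (Subtype.instMeasurableSpace.prod (ℱ T.toNNReal)) φ ?_
      rw [MeasurableSpace.prod, MeasurableSpace.comap_sup, MeasurableSpace.comap_comp,
        MeasurableSpace.comap_comp]
      refine sup_le (Measurable.comap_le ?_) (Measurable.comap_le ?_)
      · exact ((measurable_real_toNNReal.comp measurable_snd).min measurable_const).subtype_mk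
      · exact measurable_fst.mono le_rfl (ℱ.le _)
    exact h1.comp_measurable hφ
  · filter_upwards [ae_timeMeasure_of_ae (μ := μ) (T := T) (q := fun _ => True) (by simp)] with z hz
    simp only [stopAt, min_eq_left (Real.toNNReal_le_toNNReal hz.2.2),
      Real.coe_toNNReal _ hz.2.1, min_eq_left hz.2.2]

namespace Admissible

variable {ℱ : Filtration ℝ≥0 mΩ} {v w : ℝ → Ω → ℝ}

theorem flowL2 (hv : Admissible T ℱ μ v) : FlowL2 T μ v := by
  have hm := aestronglyMeasurable_of_isStronglyProgressive (μ := μ) hv.progressive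
  have hm2 : AEStronglyMeasurable (fun q : Ω × ℝ => v q.2 q.1 ^ 2) (timeMeasure T μ) := hm.pow 2
  refine (memLp_two_iff_integrable_sq hm).2 ⟨hm2, ?_⟩
  rw [hasFiniteIntegral_iff_ofReal (ae_of_all _ fun _ => sq_nonneg _), timeMeasure,
    lintegral_prod _ (hm2.aemeasurable.ennreal_ofReal)]
  exact hv.square_integrable

theorem of_flowL2 (h : IsStronglyProgressive ℱ (stopAt T v)) (hv : FlowL2 T μ v) :
    Admissible T ℱ μ v := by
  refine ⟨h, ?_⟩
  have h2 : Integrable (fun q : Ω × ℝ => v q.2 q.1 ^ 2) (timeMeasure T μ) := hv.integrable_sq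
  have h3 := h2.2
  rw [hasFiniteIntegral_iff_ofReal (ae_of_all _ fun _ => sq_nonneg _), timeMeasure,
    lintegral_prod _ (h2.aemeasurable.ennreal_ofReal)] at h3
  exact h3

theorem add (hv : Admissible T ℱ μ v) (hw : Admissible T ℱ μ w) :
    Admissible T ℱ μ (fun t ω => v t ω + w t ω) :=
  of_flowL2 (fun i => (hv.progressive i).add (hw.progressive i))
    ((hv.flowL2).add (hw.flowL2))

theorem sub (hv : Admissible T ℱ μ v) (hw : Admissible T ℱ μ w) :
    Admissible T ℱ μ (fun t ω => v t ω - w t ω) :=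
  of_flowL2 (fun i => (hv.progressive i).sub (hw.progressive i))
    ((hv.flowL2).sub (hw.flowL2))

theorem const_mul (hv : Admissible T ℱ μ v) (c : ℝ) :
    Admissible T ℱ μ (fun t ω => c * v t ω) :=
  of_flowL2 (fun i => (hv.progressive i).const_mul c) ((hv.flowL2).const_mul c)

theorem of_continuous {h : ℝ → ℝ} (hh : Continuous h) :
    Admissible T ℱ μ (fun t _ => h t) := by
  refine of_flowL2 (fun i => ?_) (FlowL2.of_continuous hh)
  have h1 : Continuous fun t : Set.Iic i => h (min (((t : ℝ≥0) : ℝ)) T) := by fun_prop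
  exact h1.stronglyMeasurable.comp_measurable (@measurable_fst _ _ _ (ℱ i))

theorem stronglyMeasurable (hv : Admissible T ℱ μ v) {t : ℝ} (ht : t ∈ Set.Icc 0 T) :
    StronglyMeasurable[ℱ t.toNNReal] (v t) := by
  have := hv.progressive.stronglyAdapted t.toNNReal
  have h : stopAt T v t.toNNReal = v t := by
    funext ω
    simp only [stopAt, Real.coe_toNNReal _ ht.1, min_eq_left ht.2]
  rwa [h] at this

end Admissible

end Basic

end LiquidationGame

/-! ### Square-integrable martingales and their orthogonality to admissible rates -/

namespace LiquidationGame

variable {Ω : Type*} {mΩ : MeasurableSpace Ω}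

theorem stopAt_toNNReal {E : Type*} {T t : ℝ} (X : ℝ → Ω → E) (ht : t ∈ Set.Icc 0 T) :
    stopAt T X t.toNNReal = X t := by
  funext ω
  simp only [stopAt, Real.coe_toNNReal _ ht.1, min_eq_left ht.2]

namespace IsSquareIntegrableMartingale

variable {μ : Measure Ω} [IsProbabilityMeasure μ] {ℱ : Filtration ℝ≥0 mΩ} {T : ℝ}
  {M : ℝ → Ω → ℝ}

theorem condExp_eq (hM : IsSquareIntegrableMartingale T ℱ μ M) {t : ℝ} (ht : t ∈ Set.Icc 0 T) :
    μ[M T | ℱ t.toNNReal] =ᵐ[μ] M t := by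
  have h := hM.martingale.2 t.toNNReal T.toNNReal (Real.toNNReal_le_toNNReal ht.2)
  rwa [stopAt_toNNReal M ht, stopAt_toNNReal M ⟨ht.1.trans ht.2, le_rfl⟩] at h

theorem integral_mul_increment (hM : IsSquareIntegrableMartingale T ℱ μ M) {t : ℝ}
    (ht : t ∈ Set.Icc 0 T) {g : Ω → ℝ} (hg : StronglyMeasurable[ℱ t.toNNReal] g)
    (hg2 : MemLp g 2 μ) : ∫ ω, (M T ω - M t ω) * g ω ∂μ = 0 := by
  have hT : T ∈ Set.Icc 0 T := ⟨ht.1.trans ht.2, le_rfl⟩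
  have hm : StronglyMeasurable[ℱ t.toNNReal] (M t) := by
    have := hM.martingale.1 t.toNNReal
    rwa [stopAt_toNNReal M ht] at this
  have hTt : MemLp (M T - M t) 2 μ := (hM.memLp T hT).sub (hM.memLp t ht)
  have hint : Integrable ((M T - M t) * g) μ := hTt.integrable_mul hg2
  have h1 := condExp_mul_of_stronglyMeasurable_right hg hint (hTt.integrable one_le_two)
  have h2 := condExp_sub (μ := μ) ((hM.memLp T hT).integrable one_le_two)
    ((hM.memLp t ht).integrable one_le_two) (ℱ t.toNNReal)
  have h3 := condExp_of_stronglyMeasurable (μ := μ) (ℱ.le t.toNNReal) hm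
    ((hM.memLp t ht).integrable one_le_two)
  calc ∫ ω, (M T ω - M t ω) * g ω ∂μ = ∫ ω, ((M T - M t) * g) ω ∂μ := rfl
    _ = ∫ ω, (μ[(M T - M t) * g | ℱ t.toNNReal]) ω ∂μ := (integral_condExp (ℱ.le _)).symm
    _ = ∫ ω, (0 : ℝ) ∂μ := by
      refine integral_congr_ae ?_
      filter_upwards [h1, h2, hM.condExp_eq ht] with ω a b c
      rw [a, Pi.mul_apply, b, Pi.sub_apply, c, h3, sub_self, zero_mul]
    _ = 0 := by simp

theorem eLpNorm_le (hM : IsSquareIntegrableMartingale T ℱ μ M) {t : ℝ} (ht : t ∈ Set.Icc 0 T) :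
    eLpNorm (M t) 2 μ ≤ eLpNorm (M T) 2 μ := by
  rw [← eLpNorm_congr_ae (hM.condExp_eq ht)]
  exact eLpNorm_condExp_le_eLpNorm _ one_le_two

/-- A càdlàg adapted process is jointly measurable, up to a null set. -/
theorem aestronglyMeasurable (hM : IsSquareIntegrableMartingale T ℱ μ M) :
    AEStronglyMeasurable (fun q : Ω × ℝ => M q.2 q.1) (timeMeasure T μ) := by
  -- Grid points strictly to the right of `t` that converge to `t`. For each `n` the grid is
  -- countable, which gives measurability; right continuity gives convergence.
  let a : ℕ → ℝ → ℝ := fun n t => ((⌊((n : ℝ) + 1) * t⌋ : ℤ) + 1 : ℝ) / ((n : ℝ) + 1)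
  have ha1 : ∀ n t, t < a n t := fun n t => by
    rw [lt_div_iff₀ (by positivity), mul_comm]
    exact Int.lt_floor_add_one _
  have ha2 : ∀ n t, a n t ≤ t + 1 / ((n : ℝ) + 1) := fun n t => by
    rw [div_le_iff₀ (by positivity), add_mul t, one_div, inv_mul_cancel₀ (by positivity), mul_comm t]
    have := Int.floor_le (((n : ℝ) + 1) * t)
    linarith
  have ha3 : ∀ t, Tendsto (fun n => a n t) atTop (𝓝 t) := fun t => by
    refine tendsto_of_tendsto_of_tendsto_of_le_of_le tendsto_const_nhds ?_
      (fun n => (ha1 n t).le) (fun n => ha2 n t)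
    simpa using tendsto_const_nhds.add (tendsto_one_div_add_atTop_nhds_zero_nat (𝕜 := ℝ))
  refine aestronglyMeasurable_of_tendsto_ae atTop
    (f := fun n (q : Ω × ℝ) => stopAt T M (a n q.2).toNNReal q.1) (fun n => ?_) ?_
  · have hG : Measurable fun r : ℤ × Ω =>
        stopAt T M (((r.1 : ℝ) + 1) / ((n : ℝ) + 1)).toNNReal r.2 :=
      measurable_from_prod_countable_right fun k =>
        ((hM.martingale.1 (((k : ℝ) + 1) / ((n : ℝ) + 1)).toNNReal).mono (ℱ.le _)).measurable
    have hφ : Measurable fun q : Ω × ℝ => (⌊((n : ℝ) + 1) * q.2⌋, q.1) :=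
      (Int.measurable_floor.comp (measurable_snd.const_mul _)).prodMk measurable_fst
    exact (hG.comp hφ).aestronglyMeasurable
  · have hne : ∀ᵐ q ∂(timeMeasure T μ), q.2 ≠ T :=
      Measure.quasiMeasurePreserving_snd.ae (p := fun t : ℝ => t ≠ T)
        (ae_restrict_of_ae (Measure.ae_ne volume T))
    filter_upwards [ae_timeMeasure_of_ae (T := T) hM.cadlag, hne] with q hq hqT
    have hlt : q.2 < T := lt_of_le_of_ne hq.2.2 hqT
    have hc := hq.1.1 q.2 ⟨hq.2.1, hlt⟩
    have h1 : Tendsto (fun n => a n q.2) atTop (𝓝[Set.Ici q.2] q.2) :=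
      tendsto_nhdsWithin_iff.2 ⟨ha3 _, Eventually.of_forall fun n => (ha1 n _).le⟩
    refine (hc.tendsto.comp h1).congr' ?_
    filter_upwards [(ha3 q.2).eventually_lt_const hlt] with n hn
    rw [stopAt_toNNReal M ⟨hq.2.1.trans (ha1 n _).le, hn.le⟩]
    rfl

/-- Conditional expectation contracts `L²`, so the second moment at `T` bounds all earlier ones;
Tonelli integrates this bound over time. -/
theorem flowL2 (hM : IsSquareIntegrableMartingale T ℱ μ M) (hT : 0 ≤ T) : FlowL2 T μ M := by
  have hm := hM.aestronglyMeasurable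
  refine ⟨hm, ?_⟩
  rw [eLpNorm_lt_top_iff_lintegral_rpow_enorm_lt_top two_ne_zero ENNReal.ofNat_ne_top]
  have hmeas : AEMeasurable (fun q : Ω × ℝ => ‖M q.2 q.1‖ₑ ^ (2 : ℝ≥0∞).toReal)
      (μ.prod (volume.restrict (Set.Icc 0 T))) := hm.enorm.pow_const _
  rw [timeMeasure, lintegral_prod_symm _ hmeas]
  have hC : ∫⁻ ω, ‖M T ω‖ₑ ^ (2 : ℝ≥0∞).toReal ∂μ < ∞ :=
    (eLpNorm_lt_top_iff_lintegral_rpow_enorm_lt_top two_ne_zero ENNReal.ofNat_ne_top).1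
      (hM.memLp T ⟨hT, le_rfl⟩).2
  calc _ ≤ ∫⁻ _ in Set.Icc 0 T, ∫⁻ ω, ‖M T ω‖ₑ ^ (2 : ℝ≥0∞).toReal ∂μ := by
        refine setLIntegral_mono' measurableSet_Icc fun t ht => ?_
        have := hM.eLpNorm_le ht
        rw [eLpNorm_eq_lintegral_rpow_enorm_toReal two_ne_zero ENNReal.ofNat_ne_top,
          eLpNorm_eq_lintegral_rpow_enorm_toReal two_ne_zero ENNReal.ofNat_ne_top] at this
        rwa [ENNReal.rpow_le_rpow_iff (by simp)] at this
    _ < ∞ := by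
        rw [lintegral_const]
        refine ENNReal.mul_lt_top hC ?_
        simp

/-- The increments of the martingale up to `T` are orthogonal to all admissible rates. -/
theorem integral_increment_mul (hM : IsSquareIntegrableMartingale T ℱ μ M) (hT : 0 ≤ T)
    {w : ℝ → Ω → ℝ} (hw : Admissible T ℱ μ w) :
    ∫ ω, (∫ t in (0 : ℝ)..T, (M T ω - M t ω) * w t ω) ∂μ = 0 := by
  have hZ : FlowL2 T μ (fun t ω => M T ω - M t ω) :=
    (FlowL2.of_memLp (hM.memLp T ⟨hT, le_rfl⟩)).sub (hM.flowL2 hT)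
  have hint : Integrable (fun q : Ω × ℝ => (M T q.1 - M q.2 q.1) * w q.2 q.1)
    (μ.prod (volume.restrict (Set.Icc 0 T))) := MemLp.integrable_mul hZ hw.flowL2
  simp only [← integral_Icc_eq_interval hT]
  -- After Fubini the inner expectation vanishes for almost every fixed `t`, where `w_t` is
  -- `ℱ_t`-measurable and square-integrable.
  rw [integral_integral_swap hint]
  have hsq : Integrable (fun q : Ω × ℝ => w q.2 q.1 ^ 2)
    (μ.prod (volume.restrict (Set.Icc 0 T))) := MemLp.integrable_sq hw.flowL2
  refine integral_eq_zero_of_ae ?_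
  filter_upwards [hsq.prod_left_ae, ae_restrict_mem measurableSet_Icc] with t h1 ht
  have hs := hw.stronglyMeasurable ht
  exact hM.integral_mul_increment ht hs
    ((memLp_two_iff_integrable_sq (hs.mono (ℱ.le _)).aestronglyMeasurable).2 h1)

end IsSquareIntegrableMartingale

end LiquidationGame

/-! ### Integrability of the terminal price, and càdlàg paths -/

namespace LiquidationGame

variable {Ω : Type*} {mΩ : MeasurableSpace Ω} {μ : Measure Ω} [IsProbabilityMeasure μ]
  {ℱ : Filtration ℝ≥0 mΩ} {T : ℝ}

/-- Localization and Fatou: along the localizing sequence the expected squared increment of `L` is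
at most `E[C_T]`, since `C` is nondecreasing. -/
theorem HasPredictableQuadraticVariation.memLp_increment {L C : ℝ → Ω → ℝ}
    (h : HasPredictableQuadraticVariation T ℱ μ L C) (hT : 0 ≤ T)
    (hC : (∫⁻ ω, ENNReal.ofReal (C T ω) ∂μ) < ∞) :
    MemLp (fun ω => L T ω - L 0 ω) 2 μ := by
  obtain ⟨τ, hτ, hmart⟩ := h.localMartingale.locally_martingale
  have hT0 : (0 : ℝ) ∈ Set.Icc 0 T := ⟨le_rfl, hT⟩
  have hTT : T ∈ Set.Icc 0 T := ⟨hT, le_rfl⟩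
  have hCm : AEStronglyMeasurable (C T) μ := by
    have := h.predictable.stronglyAdapted T.toNNReal
    rw [stopAt_toNNReal C hTT] at this
    exact (this.mono (ℱ.le _)).aestronglyMeasurable
  have hC0 : ∀ᵐ ω ∂μ, 0 ≤ C T ω := by
    filter_upwards [h.zero, h.mono] with ω h0 hm
    rw [← h0]; exact hm hT0 hTT hT
  have hCi : Integrable (C T) μ := ⟨hCm, (hasFiniteIntegral_iff_ofReal hC0).2 hC⟩
  set Q : ℝ≥0 → Ω → ℝ × ℝ := stopAt T (fun t ω => (L t ω, (L t ω - L 0 ω) ^ 2 - C t ω)) with hQ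
  set N : ℕ → ℝ≥0 → Ω → ℝ × ℝ := fun n =>
    stoppedProcess (fun i => {ω | ⊥ < τ n ω}.indicator (Q i)) (τ n) with hN
  have hNint : ∀ n t, Integrable (N n t) μ := fun n t => (hmart n).integrable t
  -- The localized process carries the indicator of `τ n > 0`: it vanishes identically where `τ n =
  -- 0`, and elsewhere it is `Q` evaluated at a time in `[0,T]`.
  have cases : ∀ n ω, (N n T.toNNReal ω = 0 ∧ N n 0 ω = 0) ∨
      ∃ r ∈ Set.Icc 0 T, N n T.toNNReal ω = (L r ω, (L r ω - L 0 ω) ^ 2 - C r ω) ∧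
        N n 0 ω = (L 0 ω, - C 0 ω) := by
    intro n ω
    by_cases hω : ⊥ < τ n ω
    · right
      refine ⟨min ((min (T.toNNReal : WithTop ℝ≥0) (τ n ω)).untopA : ℝ) T,
        ⟨le_min NNReal.zero_le_coe hT, min_le_right _ _⟩, ?_, ?_⟩
      · simp only [hN, stoppedProcess]
        rw [Set.indicator_of_mem (by exact hω)]
        rfl
      · simp only [hN, stoppedProcess]
        rw [Set.indicator_of_mem (by exact hω)]
        have : (min ((0 : ℝ≥0) : WithTop ℝ≥0) (τ n ω)) = ((0 : ℝ≥0) : WithTop ℝ≥0) :=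
          min_eq_left (by simp)
        rw [this, WithTop.untopA, WithTop.untopD_coe]
        simp [hQ, stopAt, min_eq_left hT]
    · left
      simp only [hN, stoppedProcess]
      rw [Set.indicator_of_notMem (by exact hω), Set.indicator_of_notMem (by exact hω)]
      exact ⟨rfl, rfl⟩
  have hint0 : ∀ n, ∫ ω, (N n T.toNNReal ω).2 ∂μ = 0 := by
    intro n
    have e1 : ∫ ω, N n T.toNNReal ω ∂μ = ∫ ω, N n 0 ω ∂μ := by
      rw [← integral_condExp (ℱ.le 0)]
      exact integral_congr_ae ((hmart n).2 0 T.toNNReal zero_le)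
    have e2 : ∫ ω, (N n T.toNNReal ω).2 ∂μ = ∫ ω, (N n 0 ω).2 ∂μ := by
      rw [← snd_integral (hNint n _), ← snd_integral (hNint n _), e1]
    rw [e2]
    refine integral_eq_zero_of_ae ?_
    filter_upwards [h.zero] with ω h0
    rcases cases n ω with ⟨_, hc⟩ | ⟨r, _, _, hc⟩
    · rw [hc]; rfl
    · rw [hc, h0]; simp
  have hbound : ∀ n, ∀ᵐ ω ∂μ,
      ((N n T.toNNReal ω).1 - (N n 0 ω).1) ^ 2 ≤ (N n T.toNNReal ω).2 + C T ω := by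
    intro n
    filter_upwards [hC0, h.mono] with ω h0 hm
    rcases cases n ω with ⟨ha, hb⟩ | ⟨r, hr, ha, hb⟩
    · rw [ha, hb]; simpa using h0
    · rw [ha, hb]
      have := hm hr hTT hr.2
      dsimp only at this ⊢
      linarith
  have hmeas : ∀ n, AEStronglyMeasurable
      (fun ω => (N n T.toNNReal ω).1 - (N n 0 ω).1) μ := fun n =>
    (hNint n _).fst.aestronglyMeasurable.sub (hNint n _).fst.aestronglyMeasurable
  have hlim : ∀ᵐ ω ∂μ, ∀ᶠ n in atTop,
      (N n T.toNNReal ω).1 - (N n 0 ω).1 = L T ω - L 0 ω := by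
    filter_upwards [hτ.tendsto_top] with ω hω
    filter_upwards [hω.eventually_const_lt (WithTop.coe_lt_top T.toNNReal)] with n hn
    have hb : ⊥ < τ n ω := lt_of_le_of_lt bot_le hn
    have e : ∀ t : ℝ≥0, t ≤ T.toNNReal → N n t ω = Q t ω := fun t ht => by
      simp only [hN, stoppedProcess]
      rw [Set.indicator_of_mem (by exact hb), min_eq_left
        ((WithTop.coe_le_coe.2 ht).trans hn.le), WithTop.untopA, WithTop.untopD_coe]
    rw [e _ le_rfl, e 0 zero_le]
    simp [hQ, stopAt, hT]
  have hLm : AEStronglyMeasurable (fun ω => L T ω - L 0 ω) μ := by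
    refine aestronglyMeasurable_of_tendsto_ae atTop hmeas ?_
    filter_upwards [hlim] with ω hω
    exact tendsto_const_nhds.congr' (hω.mono fun n hn => hn.symm)
  refine (memLp_two_iff_integrable_sq hLm).2 ⟨hLm.pow 2, ?_⟩
  rw [hasFiniteIntegral_iff_ofReal (ae_of_all _ fun _ => sq_nonneg _)]
  have hfatou : ∫⁻ ω, ENNReal.ofReal ((L T ω - L 0 ω) ^ 2) ∂μ
      ≤ liminf (fun n => ∫⁻ ω, ENNReal.ofReal
        (((N n T.toNNReal ω).1 - (N n 0 ω).1) ^ 2) ∂μ) atTop := by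
    refine le_trans (lintegral_mono_ae ?_)
      (lintegral_liminf_le' fun n => ((hmeas n).pow 2).aemeasurable.ennreal_ofReal)
    filter_upwards [hlim] with ω hω
    refine le_of_eq (Tendsto.liminf_eq ?_).symm
    exact tendsto_const_nhds.congr' (hω.mono fun n hn => by simp [hn])
  refine lt_of_le_of_lt hfatou (lt_of_le_of_lt ?_
    (ENNReal.ofReal_lt_top (r := ∫ ω, C T ω ∂μ)))
  refine liminf_le_of_le (by isBoundedDefault) fun b hb => ?_
  obtain ⟨n, hn⟩ := hb.exists
  refine hn.trans ?_
  have hsum : Integrable (fun ω => (N n T.toNNReal ω).2 + C T ω) μ := (hNint n _).snd.add hCi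
  calc _ ≤ ∫⁻ ω, ENNReal.ofReal ((N n T.toNNReal ω).2 + C T ω) ∂μ :=
        lintegral_mono_ae ((hbound n).mono fun ω hω => ENNReal.ofReal_le_ofReal hω)
    _ = ENNReal.ofReal (∫ ω, ((N n T.toNNReal ω).2 + C T ω) ∂μ) :=
        (ofReal_integral_eq_lintegral_ofReal hsum
          ((hbound n).mono fun ω hω => (sq_nonneg _).trans hω)).symm
    _ = ENNReal.ofReal (∫ ω, C T ω ∂μ) := by
        rw [integral_add (hNint n _).snd hCi, hint0, zero_add]

/-- `P_T = P_0 + (L_T - L_0) + A_T`, where the last two terms are square-integrable, `|A_T|` being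
bounded by the total variation. `P_0` is only integrable, so no more can be claimed for `P_T`. -/
theorem IsH2.integrable_terminal {P : ℝ → Ω → ℝ} (hP : IsH2 T ℱ μ P) (hT : 0 ≤ T) :
    Integrable (P T) μ := by
  obtain ⟨hP0, L, A, C, hPLA, hLC, hA, hA0, -, hC, hV⟩ := hP
  have hTT : T ∈ Set.Icc 0 T := ⟨hT, le_rfl⟩
  have hAm : AEStronglyMeasurable (A T) μ := by
    have := hA.stronglyAdapted T.toNNReal
    rw [stopAt_toNNReal A hTT] at this
    exact (this.mono (ℱ.le _)).aestronglyMeasurable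
  have hA2 : MemLp (A T) 2 μ := by
    refine ⟨hAm, ?_⟩
    rw [eLpNorm_lt_top_iff_lintegral_rpow_enorm_lt_top two_ne_zero ENNReal.ofNat_ne_top]
    refine lt_of_le_of_lt (lintegral_mono_ae ?_) hV
    filter_upwards [hA0] with ω h0
    have := eVariationOn.edist_le (fun t => A t ω) (s := Set.Icc 0 T) hTT ⟨le_rfl, hT⟩
    rw [h0, edist_zero_right] at this
    simp only [ENNReal.toReal_ofNat, ENNReal.rpow_ofNat]
    gcongr
  have hL2 := hLC.memLp_increment hT hC
  refine ((hP0.add (hL2.integrable one_le_two)).add (hA2.integrable one_le_two)).congr ?_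
  filter_upwards [hPLA, hA0] with ω h h0
  have h1 := h T hTT
  have h2 := h 0 ⟨le_rfl, hT⟩
  simp only [Pi.add_apply]
  rw [h1, h2, h0]; ring

namespace IsCadlagOn

variable {f g : ℝ → ℝ}

theorem congr (hf : IsCadlagOn T f) (h : ∀ t ∈ Set.Icc 0 T, f t = g t) : IsCadlagOn T g := by
  refine ⟨fun t ht => ?_, fun t ht => ?_⟩
  · refine (hf.1 t ht).congr_of_eventuallyEq ?_ (h t ⟨ht.1, ht.2.le⟩).symm
    filter_upwards [self_mem_nhdsWithin, mem_nhdsWithin_of_mem_nhds (Iio_mem_nhds ht.2)]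
      with s h1 h2 using (h s ⟨ht.1.trans h1, le_of_lt h2⟩).symm
  · obtain ⟨l, hl⟩ := hf.2 t ht
    refine ⟨l, hl.congr' ?_⟩
    filter_upwards [self_mem_nhdsWithin, mem_nhdsWithin_of_mem_nhds (Ioi_mem_nhds ht.1)]
      with s h1 h2 using h s ⟨le_of_lt h2, (le_of_lt h1).trans ht.2⟩

theorem of_continuousOn (hf : ContinuousOn f (Set.Icc 0 T)) : IsCadlagOn T f := by
  refine ⟨fun t ht => ?_, fun t ht => ⟨f t, ?_⟩⟩
  · refine (hf t ⟨ht.1, ht.2.le⟩).mono_of_mem_nhdsWithin ?_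
    filter_upwards [self_mem_nhdsWithin, mem_nhdsWithin_of_mem_nhds (Iio_mem_nhds ht.2)]
      with s h1 h2 using ⟨ht.1.trans h1, le_of_lt h2⟩
  · refine (hf t ⟨ht.1.le, ht.2⟩).mono_of_mem_nhdsWithin ?_
    filter_upwards [self_mem_nhdsWithin, mem_nhdsWithin_of_mem_nhds (Ioi_mem_nhds ht.1)]
      with s h1 h2 using ⟨le_of_lt h2, (le_of_lt h1).trans ht.2⟩

theorem add (hf : IsCadlagOn T f) (hg : IsCadlagOn T g) : IsCadlagOn T (fun t => f t + g t) :=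
  ⟨fun t ht => (hf.1 t ht).add (hg.1 t ht), fun t ht =>
    let ⟨_, ha⟩ := hf.2 t ht
    let ⟨_, hb⟩ := hg.2 t ht
    ⟨_, ha.add hb⟩⟩

theorem const_mul (hf : IsCadlagOn T f) (c : ℝ) : IsCadlagOn T (fun t => c * f t) :=
  ⟨fun t ht => (hf.1 t ht).const_mul c, fun t ht =>
    let ⟨_, ha⟩ := hf.2 t ht
    ⟨_, ha.const_mul c⟩⟩

theorem const (c : ℝ) : IsCadlagOn T (fun _ => c) := of_continuousOn continuousOn_const

/-- Right-continuous functions that agree almost everywhere agree before the horizon. -/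
theorem eq_of_ae_eq (hf : IsCadlagOn T f) (hg : IsCadlagOn T g)
    (h : ∀ᵐ t ∂(volume.restrict (Set.Icc 0 T)), f t = g t) {t : ℝ} (ht : t ∈ Set.Ico 0 T) :
    f t = g t := by
  rw [ae_restrict_iff' measurableSet_Icc] at h
  -- Otherwise the functions would differ on a whole interval to the right of `t`, which has
  -- positive measure.
  have hfreq : ∃ᶠ s in 𝓝[>] t, f s = g s := by
    intro hn
    have hn' : ∀ᶠ s in 𝓝[>] t, s ∈ Set.Ioo t T ∧ ¬ f s = g s :=
      Eventually.and (eventually_mem_set.2 (Ioo_mem_nhdsGT ht.2)) hn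
    obtain ⟨u, hu, hsub⟩ := (mem_nhdsGT_iff_exists_Ioo_subset).1 hn'
    have hnull : volume (Set.Ioo t u) = 0 := by
      refine measure_mono_null (fun s hs => ?_) h
      have := hsub hs
      simp only [Set.mem_compl_iff, Set.mem_ofPred_eq] at this ⊢
      exact fun hc => this.2 (hc ⟨ht.1.trans this.1.1.le, this.1.2.le⟩)
    rw [Real.volume_Ioo, ENNReal.ofReal_eq_zero] at hnull
    have : t < u := hu
    linarith
  have hf' := (hf.1 t ht).mono (Set.Ioi_subset_Ici_self)
  have hg' := (hg.1 t ht).mono (Set.Ioi_subset_Ici_self)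
  by_contra hne
  have := (hf'.tendsto.sub hg'.tendsto).eventually_ne (sub_ne_zero.2 hne)
  exact hfreq (this.mono fun s hs => sub_ne_zero.1 hs)

end IsCadlagOn

theorem IsH2.cadlag {P : ℝ → Ω → ℝ} (hP : IsH2 T ℱ μ P) :
    ∀ᵐ ω ∂μ, IsCadlagOn T (fun t => P t ω) := by
  obtain ⟨-, L, A, C, hPLA, hLC, -, -, hA, -, -⟩ := hP
  filter_upwards [hPLA, hLC.localMartingale.cadlag, hA] with ω h hL hA
  have hL' : IsCadlagOn T (fun t => L t ω) :=
    ⟨fun t ht => (hL.1 t ht).fst, fun t ht =>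
      let ⟨_, ha⟩ := hL.2 t ht
      ⟨_, ha.fst_nhds⟩⟩
  exact (hL'.add hA).congr fun t ht => (h t ht).symm

end LiquidationGame

/-! ### Expansion of the objective, existence and uniqueness of the equilibrium -/

namespace LiquidationGame

variable {Ω : Type*} {mΩ : MeasurableSpace Ω} {μ : Measure Ω} [IsProbabilityMeasure μ]
  {ℱ : Filtration ℝ≥0 mΩ}

theorem integral_add_sub_sub {a b c d : Ω → ℝ} (ha : Integrable a μ) (hb : Integrable b μ)
    (hc : Integrable c μ) (hd : Integrable d μ) :
    ∫ ω, (a ω + b ω - c ω - d ω) ∂μ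
      = (∫ ω, a ω ∂μ) + (∫ ω, b ω ∂μ) - (∫ ω, c ω ∂μ) - ∫ ω, d ω ∂μ := by
  have h1 : Integrable (fun ω => a ω + b ω) μ := ha.add hb
  have h2 : Integrable (fun ω => a ω + b ω - c ω) μ := h1.sub hc
  rw [integral_sub h2 hd, integral_sub h1 hc, integral_add ha hb]

theorem pathEnergy_sub_left (p : Params) {u v w : ℝ → ℝ} (hu : PathL2 p.T u) (hv : PathL2 p.T v)
    (hw : PathL2 p.T w) :
    pathEnergy p (fun t => u t - v t) w = pathEnergy p u w - pathEnergy p v w := by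
  have hT := p.T_pos.le
  have hV : ∀ t ∈ Set.Icc 0 p.T, ∫ s in (0 : ℝ)..t, (u s - v s)
      = (∫ s in (0 : ℝ)..t, u s) - ∫ s in (0 : ℝ)..t, v s := fun t ht =>
    intervalIntegral.integral_sub (hu.intervalIntegrable_sub hT ht)
      (hv.intervalIntegrable_sub hT ht)
  have hW := hw.primitive hT
  have e1 : ∫ t in (0 : ℝ)..p.T, (u t - v t) * w t
      = (∫ t in (0 : ℝ)..p.T, u t * w t) - ∫ t in (0 : ℝ)..p.T, v t * w t := by
    rw [← intervalIntegral.integral_sub (hu.mul hT hw) (hv.mul hT hw)]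
    exact integral_congr_Icc hT fun t _ => by ring
  have e2 : ∫ t in (0 : ℝ)..p.T, (∫ s in (0 : ℝ)..t, (u s - v s)) * (∫ s in (0 : ℝ)..t, w s)
      = (∫ t in (0 : ℝ)..p.T, (∫ s in (0 : ℝ)..t, u s) * (∫ s in (0 : ℝ)..t, w s))
        - ∫ t in (0 : ℝ)..p.T, (∫ s in (0 : ℝ)..t, v s) * (∫ s in (0 : ℝ)..t, w s) := by
    rw [← intervalIntegral.integral_sub ((hu.primitive hT).mul hT hW)
      ((hv.primitive hT).mul hT hW)]
    refine integral_congr_Icc hT fun t ht => ?_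
    rw [hV t ht]; ring
  simp only [pathEnergy]
  rw [e1, e2, hV p.T ⟨hT, le_rfl⟩]
  ring

theorem FlowL2.integrable_pathEnergy {p : Params} {u w : ℝ → Ω → ℝ} (hu : FlowL2 p.T μ u)
    (hw : FlowL2 p.T μ w) :
    Integrable (fun ω => pathEnergy p (fun t => u t ω) (fun t => w t ω)) μ :=
  (((hu.integrable_integral_mul p.T_pos.le hw).const_mul p.lam).add
    (((hu.primitive p.T_pos).integrable_integral_mul p.T_pos.le
      (hw.primitive p.T_pos)).const_mul p.φ)).add
    (((hu.memLp_integral p.T_pos).integrable_mul (hw.memLp_integral p.T_pos)).const_mul p.varrho)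

theorem FlowL2.ae_eq_zero_of_integral_pathEnergy {p : Params} {w : ℝ → Ω → ℝ}
    (hw : FlowL2 p.T μ w)
    (h : ∫ ω, pathEnergy p (fun t => w t ω) (fun t => w t ω) ∂μ ≤ 0) :
    ∀ᵐ q ∂(timeMeasure p.T μ), w q.2 q.1 = 0 := by
  have h1 : p.lam * ∫ ω, (∫ t in (0 : ℝ)..p.T, w t ω ^ 2) ∂μ ≤ 0 := by
    rw [← integral_const_mul]
    exact (integral_mono ((hw.integrable_integral_sq p.T_pos.le).const_mul _)
      (hw.integrable_pathEnergy hw) fun ω => lam_mul_integral_sq_le_pathEnergy p _).trans h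
  have h2 : ∫ ω, (∫ t in (0 : ℝ)..p.T, w t ω ^ 2) ∂μ ≤ 0 :=
    nonpos_of_mul_nonpos_right h1 p.lam_pos
  have hsq : Integrable (fun q : Ω × ℝ => w q.2 q.1 ^ 2) (timeMeasure p.T μ) := hw.integrable_sq
  have h3 : ∫ q : Ω × ℝ, w q.2 q.1 ^ 2 ∂(timeMeasure p.T μ) = 0 := by
    refine le_antisymm ?_ (integral_nonneg fun _ => sq_nonneg _)
    rw [timeMeasure, integral_prod _ hsq]
    simpa only [integral_Icc_eq_interval p.T_pos.le] using h2
  rw [integral_eq_zero_iff_of_nonneg (fun _ => sq_nonneg _) hsq] at h3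
  filter_upwards [h3] with q hq
  simpa using hq

namespace IsMeanFieldSolution

variable {p : Params} {P X Y ν ν' v w : ℝ → Ω → ℝ} {xbar : ℝ}

theorem pathL2_drift {n y : ℝ → ℝ} (c₁ c₂ c₃ : ℝ) {x : ℝ → ℝ} (hn : PathL2 p.T n)
    (hy : ContinuousOn y (Set.Icc 0 p.T))
    (hx : ∀ t ∈ Set.Icc 0 p.T, x t = xbar - ∫ s in (0 : ℝ)..t, n s) :
    PathL2 p.T (fun s => c₁ * y s - c₂ * n s - c₃ * x s) := by
  have hX : PathL2 p.T x :=
    ((PathL2.of_continuousOn continuousOn_const).sub (hn.primitive p.T_pos.le)).congr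
      fun t ht => (hx t ht).symm
  exact (((PathL2.of_continuousOn hy).const_mul _).sub (hn.const_mul _)).sub (hX.const_mul _)

theorem cadlag (h : IsMeanFieldSolution p ℱ μ P xbar X Y ν) (hP : IsH2 p.T ℱ μ P) :
    ∀ᵐ ω ∂μ, IsCadlagOn p.T (fun t => ν t ω) := by
  obtain ⟨M, hM, hb⟩ := h.backward_ν
  filter_upwards [hb, hM.cadlag, hP.cadlag, h.forward_X, h.continuous_Y,
    h.admissible.flowL2.ae_pathL2] with ω hb hM hP hX hY hn
  have hI := IsCadlagOn.of_continuousOn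
    ((pathL2_drift (p.κ * p.ρ / (2 * p.lam)) (p.κ * p.γ / (2 * p.lam)) (p.φ / p.lam)
      hn hY hX).continuousOn_primitive p.T_pos.le)
  refine (((hI.add hM).add (hP.const_mul (1 / (2 * p.lam)))).add
    (.const (ν 0 ω - P 0 ω / (2 * p.lam) - M 0 ω))).congr fun t ht => ?_
  rw [hb t ht]; ring

/-- The backward equation read from `t` to `T`: its `Y` and `ν` drift is the increment of
`-κY/(2λ)`, which combines with `P` into the execution price, and the terminal condition replaces
`ν_T`. -/
theorem executionPrice_eq (h : IsMeanFieldSolution p ℱ μ P xbar X Y ν) :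
    ∃ M, IsSquareIntegrableMartingale p.T ℱ μ M ∧ ∀ᵐ ω ∂μ, ∀ t ∈ Set.Icc 0 p.T,
      executionPrice p P ν t ω = P p.T ω + 2 * p.lam * ν t ω
      - 2 * p.φ * ((∫ s in (0 : ℝ)..p.T, (xbar - ∫ r in (0 : ℝ)..s, ν r ω))
        - ∫ s in (0 : ℝ)..t, (xbar - ∫ r in (0 : ℝ)..s, ν r ω))
      - 2 * p.varrho * (xbar - ∫ r in (0 : ℝ)..p.T, ν r ω)
      + 2 * p.lam * (M p.T ω - M t ω) := by
  obtain ⟨M, hM, hb⟩ := h.backward_ν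
  refine ⟨M, hM, ?_⟩
  filter_upwards [hb, h.forward_X, h.continuous_Y, h.forward_Y, h.terminal_ν,
    h.admissible.flowL2.ae_pathL2] with ω hb hX hY hYeq hT hn t ht
  have hT0 := p.T_pos.le
  have hTT : p.T ∈ Set.Icc 0 p.T := ⟨hT0, le_rfl⟩
  have hY2 : PathL2 p.T (fun t => Y t ω) := .of_continuousOn hY
  have hX2 : PathL2 p.T (fun t => X t ω) :=
    ((PathL2.of_continuousOn continuousOn_const).sub (hn.primitive hT0)).congr
      fun t ht => (hX t ht).symm
  have hdist : Y t ω = distortion p ν t ω :=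
    eq_exp_of_integral_eq hY (hn.intervalIntegrable hT0) hYeq ht
  have eX : ∀ s ∈ Set.Icc 0 p.T, ∫ r in (0 : ℝ)..s, (xbar - ∫ r' in (0 : ℝ)..r, ν r' ω)
      = ∫ r in (0 : ℝ)..s, X r ω := fun s hs =>
    integral_congr_Icc hs.1 fun r hr => (hX r ⟨hr.1, hr.2.trans hs.2⟩).symm
  have eY : ∀ s ∈ Set.Icc 0 p.T, Y s ω = p.y + (-p.ρ * (∫ r in (0 : ℝ)..s, Y r ω)
      + p.γ * ∫ r in (0 : ℝ)..s, ν r ω) := fun s hs => by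
    rw [hYeq s hs, intervalIntegral.integral_add
      ((hY2.intervalIntegrable_sub hT0 hs).const_mul _)
      ((hn.intervalIntegrable_sub hT0 hs).const_mul _), intervalIntegral.integral_const_mul,
      intervalIntegral.integral_const_mul]
  have eI : ∀ s ∈ Set.Icc 0 p.T, ∫ r in (0 : ℝ)..s, (p.κ * p.ρ / (2 * p.lam) * Y r ω
      - p.κ * p.γ / (2 * p.lam) * ν r ω - p.φ / p.lam * X r ω)
      = p.κ * p.ρ / (2 * p.lam) * (∫ r in (0 : ℝ)..s, Y r ω)
        - p.κ * p.γ / (2 * p.lam) * (∫ r in (0 : ℝ)..s, ν r ω)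
        - p.φ / p.lam * ∫ r in (0 : ℝ)..s, X r ω := fun s hs => by
    have i1 := (hY2.intervalIntegrable_sub hT0 hs).const_mul (p.κ * p.ρ / (2 * p.lam))
    have i2 := (hn.intervalIntegrable_sub hT0 hs).const_mul (p.κ * p.γ / (2 * p.lam))
    have i3 := (hX2.intervalIntegrable_sub hT0 hs).const_mul (p.φ / p.lam)
    rw [intervalIntegral.integral_sub (i1.sub i2) i3, intervalIntegral.integral_sub i1 i2]
    simp only [intervalIntegral.integral_const_mul]
  have b1 := hb t ht
  have b2 := hb p.T hTT
  rw [eI _ ht] at b1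
  rw [eI _ hTT, hT] at b2
  have y1 := eY t ht
  have y2 := eY p.T hTT
  rw [executionPrice, ← hdist, eX _ ht, eX _ hTT, ← hX p.T hTT]
  have hl := p.lam_pos.ne'
  field_simp at b1 b2
  linear_combination b2 - b1 + p.κ * y2 - p.κ * y1

/-- The first order term in the expansion of the objective. -/
theorem objective_add (h : IsMeanFieldSolution p ℱ μ P xbar X Y ν) (hP : IsH2 p.T ℱ μ P)
    (hν' : Admissible p.T ℱ μ ν') (x : ℝ) (hv : Admissible p.T ℱ μ v)
    (hw : Admissible p.T ℱ μ w) (ε : ℝ) :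
    objective p μ P x (fun t ω => v t ω + ε * w t ω) ν' = objective p μ P x v ν'
      - ε * (∫ ω, (2 * pathEnergy p
            (fun t => v t ω - (ν t ω + (x - xbar) * unitRate p t)) (fun t => w t ω)
          + p.κ * ∫ t in (0 : ℝ)..p.T, (distortion p ν' t ω - distortion p ν t ω) * w t ω) ∂μ)
      - ε ^ 2 * ∫ ω, pathEnergy p (fun t => w t ω) (fun t => w t ω) ∂μ := by
  obtain ⟨M, hM, hS⟩ := h.executionPrice_eq
  have hT := p.T_pos
  have fν := h.admissible.flowL2
  have fv := hv.flowL2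
  have fw := hw.flowL2
  have fd := (hν'.flowL2.distortion p).sub (fν.distortion p)
  have fZ : FlowL2 p.T μ (fun t ω => M p.T ω - M t ω) :=
    (FlowL2.of_memLp (hM.memLp p.T ⟨hT.le, le_rfl⟩)).sub (hM.flowL2 hT.le)
  have fζ : FlowL2 p.T μ (fun t ω => v t ω - (ν t ω + (x - xbar) * unitRate p t)) :=
    fv.sub (fν.add ((FlowL2.of_continuous (continuous_unitRate p)).const_mul _))
  have fX : ∀ {x : ℝ} {v : ℝ → Ω → ℝ}, FlowL2 p.T μ v →
      FlowL2 p.T μ (fun t ω => x - ∫ s in (0 : ℝ)..t, v s ω) := fun hv =>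
    (FlowL2.of_continuous continuous_const).sub (hv.primitive hT)
  have hS' : ∀ᵐ ω ∂μ, ∀ t ∈ Set.Icc 0 p.T, executionPrice p P ν' t ω =
      P p.T ω + 2 * p.lam * ν t ω
      - 2 * p.φ * ((∫ s in (0 : ℝ)..p.T, (xbar - ∫ r in (0 : ℝ)..s, ν r ω))
        - ∫ s in (0 : ℝ)..t, (xbar - ∫ r in (0 : ℝ)..s, ν r ω))
      - 2 * p.varrho * (xbar - ∫ r in (0 : ℝ)..p.T, ν r ω)
      + 2 * p.lam * (M p.T ω - M t ω)
      - p.κ * (distortion p ν' t ω - distortion p ν t ω) := by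
    filter_upwards [hS] with ω hω t ht
    rw [← hω t ht, executionPrice, executionPrice]; ring
  -- `P` itself need not be square-integrable, but by the price formula its deviation from `P_T` is,
  -- once the distortion is subtracted.
  have fB : FlowL2 p.T μ (fun t ω => executionPrice p P ν' t ω - P p.T ω) := by
    refine FlowL2.congr ?_ (hS'.mono fun ω hω t ht => by rw [hω t ht])
    refine (((((fν.const_mul (2 * p.lam)).sub
      (((FlowL2.of_memLp ((fX (x := xbar) fν).memLp_integral hT)).sub
        ((fX (x := xbar) fν).primitive hT)).const_mul (2 * p.φ))).sub
      ((FlowL2.of_memLp ((memLp_const xbar).sub (fν.memLp_integral hT))).const_mul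
        (2 * p.varrho))).add (fZ.const_mul (2 * p.lam))).sub (fd.const_mul p.κ)).congr
      (ae_of_all _ fun ω t _ => ?_)
    simp only [Pi.sub_apply]
    ring
  have pS : ∀ᵐ ω ∂μ, PathL2 p.T (fun t => executionPrice p P ν' t ω) := by
    filter_upwards [fB.ae_pathL2] with ω hω
    refine (hω.add (.of_continuousOn (continuousOn_const (c := P p.T ω)))).congr fun t _ => ?_
    ring
  have payoff_integrable : Integrable (fun ω => pathPayoff p
      (fun t => executionPrice p P ν' t ω) (P p.T ω) x (fun t => v t ω)) μ := by
    have hXT : MemLp (fun ω => x - ∫ s in (0 : ℝ)..p.T, v s ω) 2 μ :=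
      (memLp_const x).sub (fv.memLp_integral hT)
    -- The identity `∫Sv + X_T P_T = xP_T + ∫(S - P_T)v` pairs `P_T` only with the constant `x`, so
    -- integrability of `P_T` suffices.
    have hi := (((((hP.integrable_terminal hT.le).const_mul x).add
      (fB.integrable_integral_mul hT.le fv)).sub
      ((fv.integrable_integral_sq hT.le).const_mul p.lam)).sub
      (((fX (x := x) fv).integrable_integral_sq hT.le).const_mul p.φ)).sub
      (hXT.integrable_sq.const_mul p.varrho)
    refine hi.congr ?_
    filter_upwards [pS, fv.ae_pathL2] with ω hSω hvω
    have e : ∫ t in (0 : ℝ)..p.T, (executionPrice p P ν' t ω - P p.T ω) * v t ω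
        = (∫ t in (0 : ℝ)..p.T, executionPrice p P ν' t ω * v t ω)
          - P p.T ω * ∫ t in (0 : ℝ)..p.T, v t ω := by
      rw [← intervalIntegral.integral_const_mul,
        ← intervalIntegral.integral_sub (hSω.mul hT.le hvω)
          ((hvω.intervalIntegrable hT.le).const_mul _)]
      exact integral_congr_Icc hT.le fun t _ => by ring
    simp only [Pi.sub_apply, Pi.add_apply, pathPayoff]
    rw [e]; ring
  have hZw := hM.integral_increment_mul hT.le hw
  have i1 := (fZ.integrable_integral_mul hT.le fw).const_mul (ε * (2 * p.lam))
  have i2 : Integrable (fun ω => 2 * pathEnergy p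
            (fun t => v t ω - (ν t ω + (x - xbar) * unitRate p t)) (fun t => w t ω)
          + p.κ * ∫ t in (0 : ℝ)..p.T, (distortion p ν' t ω - distortion p ν t ω) * w t ω) μ :=
    ((fζ.integrable_pathEnergy fw).const_mul 2).add
      ((fd.integrable_integral_mul hT.le fw).const_mul p.κ)
  have i3 := (fw.integrable_pathEnergy fw).const_mul (ε ^ 2)
  have key : ∀ᵐ ω ∂μ, pathPayoff p (fun t => executionPrice p P ν' t ω) (P p.T ω) x
      (fun t => v t ω + ε * w t ω)
      = pathPayoff p (fun t => executionPrice p P ν' t ω) (P p.T ω) x (fun t => v t ω)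
        + ε * (2 * p.lam) * (∫ t in (0 : ℝ)..p.T, (M p.T ω - M t ω) * w t ω)
        - ε * (2 * pathEnergy p
            (fun t => v t ω - (ν t ω + (x - xbar) * unitRate p t)) (fun t => w t ω)
          + p.κ * ∫ t in (0 : ℝ)..p.T, (distortion p ν' t ω - distortion p ν t ω) * w t ω)
        - ε ^ 2 * pathEnergy p (fun t => w t ω) (fun t => w t ω) := by
    filter_upwards [hS', pS, fν.ae_pathL2, fv.ae_pathL2, fw.ae_pathL2, fd.ae_pathL2,
      fZ.ae_pathL2, fζ.ae_pathL2] with ω hSω pSω hn hvω hwω hdω hZω hζω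
    rw [pathPayoff_add p _ _ _ pSω hvω hwω]
    have := pathGradient_eq p (P p.T ω) xbar (x - xbar) hn hZω hdω hζω hwω
      (v := fun t => v t ω) (fun t _ => by ring) hSω
    rw [add_sub_cancel] at this
    rw [this]; ring
  change ∫ ω, pathPayoff p (fun t => executionPrice p P ν' t ω) (P p.T ω) x
      (fun t => v t ω + ε * w t ω) ∂μ
    = (∫ ω, pathPayoff p (fun t => executionPrice p P ν' t ω) (P p.T ω) x
      (fun t => v t ω) ∂μ) - _ - _
  rw [integral_congr_ae key, integral_add_sub_sub payoff_integrable i1 (i2.const_mul ε) i3,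
    integral_const_mul, integral_const_mul, integral_const_mul,
    hZw]
  ring

/-- The first order condition. -/
theorem marginal_eq_zero (h : IsMeanFieldSolution p ℱ μ P xbar X Y ν) (hP : IsH2 p.T ℱ μ P)
    (hν' : Admissible p.T ℱ μ ν') {x : ℝ} (hv : Admissible p.T ℱ μ v)
    (hopt : ∀ w, Admissible p.T ℱ μ w → objective p μ P x w ν' ≤ objective p μ P x v ν')
    (hw : Admissible p.T ℱ μ w) :
    ∫ ω, (2 * pathEnergy p
        (fun t => v t ω - (ν t ω + (x - xbar) * unitRate p t)) (fun t => w t ω)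
      + p.κ * ∫ t in (0 : ℝ)..p.T, (distortion p ν' t ω - distortion p ν t ω) * w t ω) ∂μ
      = 0 := by
  have key := fun ε : ℝ => h.objective_add hP hν' x hv hw ε
  set G := ∫ ω, (2 * pathEnergy p
        (fun t => v t ω - (ν t ω + (x - xbar) * unitRate p t)) (fun t => w t ω)
      + p.κ * ∫ t in (0 : ℝ)..p.T, (distortion p ν' t ω - distortion p ν t ω) * w t ω) ∂μ
  set Q := ∫ ω, pathEnergy p (fun t => w t ω) (fun t => w t ω) ∂μ
  have hQ : 0 ≤ Q := integral_nonneg fun ω => pathEnergy_self_nonneg p _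
  have hle : ∀ ε : ℝ, 0 ≤ ε * G + ε ^ 2 * Q := fun ε => by
    have := hopt _ (hv.add (hw.const_mul ε))
    rw [key ε] at this
    linarith
  -- The choice `ε = -G/(Q+1)` turns the quadratic into `-G²/(Q+1)²`; the `+1` covers `Q = 0`.
  have h1 := hle (-G / (Q + 1))
  have hQ1 : 0 < Q + 1 := by linarith
  have e : -G / (Q + 1) * G + (-G / (Q + 1)) ^ 2 * Q = -(G ^ 2 / (Q + 1) ^ 2) := by
    field_simp; ring
  rw [e] at h1
  have h2 : G ^ 2 / (Q + 1) ^ 2 = 0 := le_antisymm (by linarith) (by positivity)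
  rw [div_eq_zero_iff] at h2
  rcases h2 with h2 | h2
  · exact pow_eq_zero_iff two_ne_zero |>.1 h2
  · exact absurd h2 (by positivity)

theorem admissible_equilibriumRate (h : IsMeanFieldSolution p ℱ μ P xbar X Y ν) (a : ℝ) :
    Admissible p.T ℱ μ (fun t ω => ν t ω + a * unitRate p t) :=
  h.admissible.add ((Admissible.of_continuous (continuous_unitRate p)).const_mul a)

/-- At this rate `ζ = 0` and the flows agree, so the first order term vanishes. The exact expansion
with `ε = 1` in the direction of any competitor leaves minus a nonnegative energy. -/
theorem equilibriumRate_optimal (h : IsMeanFieldSolution p ℱ μ P xbar X Y ν)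
    (hP : IsH2 p.T ℱ μ P) (x : ℝ) (hw : Admissible p.T ℱ μ w) :
    objective p μ P x w ν
      ≤ objective p μ P x (fun t ω => ν t ω + (x - xbar) * unitRate p t) ν := by
  have hv := h.admissible_equilibriumRate (x - xbar)
  have key := h.objective_add hP h.admissible x hv (hw.sub hv) 1
  have e : (fun t ω => (ν t ω + (x - xbar) * unitRate p t)
      + 1 * (w t ω - (ν t ω + (x - xbar) * unitRate p t))) = w := by
    funext t ω; ring
  rw [e] at key
  have hQ : 0 ≤ ∫ ω, pathEnergy p (fun t => w t ω - (ν t ω + (x - xbar) * unitRate p t))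
      (fun t => w t ω - (ν t ω + (x - xbar) * unitRate p t)) ∂μ :=
    integral_nonneg fun ω => pathEnergy_self_nonneg p _
  simp only [sub_self, pathEnergy, zero_mul, intervalIntegral.integral_zero, mul_zero, add_zero,
    integral_zero] at key hQ
  linarith

theorem tendsto_average {x : ℕ → ℝ}
    (hx : Tendsto (fun N : ℕ => (∑ i ∈ Finset.range N, x i) / (N : ℝ)) atTop (𝓝 xbar))
    (a b : ℝ) :
    Tendsto (fun N : ℕ => (∑ i ∈ Finset.range N, (a + (x i - xbar) * b)) / (N : ℝ)) atTop
      (𝓝 a) := by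
  have h1 : Tendsto (fun N : ℕ => a + ((∑ i ∈ Finset.range N, x i) / (N : ℝ) - xbar) * b) atTop
      (𝓝 (a + (xbar - xbar) * b)) := ((hx.sub_const _).mul_const b).const_add a
  rw [sub_self, zero_mul, add_zero] at h1
  refine h1.congr' ?_
  filter_upwards [eventually_gt_atTop 0] with N hN
  have hN' : (N : ℝ) ≠ 0 := by positivity
  rw [Finset.sum_add_distrib, ← Finset.sum_mul, Finset.sum_sub_distrib]
  simp only [Finset.sum_const, Finset.card_range, nsmul_eq_mul]
  field_simp

/-- Every equilibrium consists of the mean field rate and a deterministic correction. -/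
theorem ae_eq_of_isNashEquilibrium (h : IsMeanFieldSolution p ℱ μ P xbar X Y ν)
    (hP : IsH2 p.T ℱ μ P) {x : ℕ → ℝ}
    (hx : Tendsto (fun N : ℕ => (∑ i ∈ Finset.range N, x i) / (N : ℝ)) atTop (𝓝 xbar))
    {v : ℕ → ℝ → Ω → ℝ} (hv : IsNashEquilibrium p ℱ μ P x v ν') (i : ℕ) :
    ∀ᵐ q ∂(timeMeasure p.T μ),
      v i q.2 q.1 = ν q.2 q.1 + (x i - xbar) * unitRate p q.2 := by
  have hT := p.T_pos
  set ζ : ℕ → ℝ → Ω → ℝ := fun i t ω => v i t ω - (ν t ω + (x i - xbar) * unitRate p t) with hζ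
  have hζa : ∀ i, Admissible p.T ℱ μ (ζ i) := fun i =>
    (hv.admissible i).sub (h.admissible_equilibriumRate _)
  have crit : ∀ i w, Admissible p.T ℱ μ w → ∫ ω, (2 * pathEnergy p
      (fun t => ζ i t ω) (fun t => w t ω)
      + p.κ * ∫ t in (0 : ℝ)..p.T, (distortion p ν' t ω - distortion p ν t ω) * w t ω) ∂μ
      = 0 := fun i w hw =>
    h.marginal_eq_zero hP hv.admissible_flow (hv.admissible i) (hv.optimal i) hw
  have fd := (hv.admissible_flow.flowL2.distortion p).sub (h.admissible.flowL2.distortion p)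
  have split : ∀ i w, Admissible p.T ℱ μ w →
      2 * (∫ ω, pathEnergy p (fun t => ζ i t ω) (fun t => w t ω) ∂μ)
      + ∫ ω, p.κ * (∫ t in (0 : ℝ)..p.T,
          (distortion p ν' t ω - distortion p ν t ω) * w t ω) ∂μ = 0 := fun i w hw => by
    have hc := crit i w hw
    rwa [integral_add (((hζa i).flowL2.integrable_pathEnergy hw.flowL2).const_mul 2)
      ((fd.integrable_integral_mul hT.le hw.flowL2).const_mul _), integral_const_mul] at hc
  have heq : ∀ i, ∀ᵐ q ∂(timeMeasure p.T μ), ζ i q.2 q.1 - ζ 0 q.2 q.1 = 0 := fun i => by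
    have hw := (hζa i).sub (hζa 0)
    refine hw.flowL2.ae_eq_zero_of_integral_pathEnergy (le_of_eq ?_)
    -- The price term does not depend on the agent, so it drops out of the difference of the two
    -- conditions.
    have h1 := split i _ hw
    have h2 := split 0 _ hw
    have e : ∫ ω, pathEnergy p (fun t => ζ i t ω - ζ 0 t ω) (fun t => ζ i t ω - ζ 0 t ω) ∂μ
        = (∫ ω, pathEnergy p (fun t => ζ i t ω) (fun t => ζ i t ω - ζ 0 t ω) ∂μ)
          - ∫ ω, pathEnergy p (fun t => ζ 0 t ω) (fun t => ζ i t ω - ζ 0 t ω) ∂μ := by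
      rw [← integral_sub ((hζa i).flowL2.integrable_pathEnergy hw.flowL2)
        ((hζa 0).flowL2.integrable_pathEnergy hw.flowL2)]
      refine integral_congr_ae ?_
      filter_upwards [(hζa i).flowL2.ae_pathL2, (hζa 0).flowL2.ae_pathL2] with ω a b
      exact pathEnergy_sub_left p a b (a.sub b)
    rw [e]; linarith
  have hflow : ∀ᵐ q ∂(timeMeasure p.T μ), ν' q.2 q.1 = ν q.2 q.1 + ζ 0 q.2 q.1 := by
    filter_upwards [hv.consistent, ae_all_iff.2 heq] with q hq hz
    -- All agents share the deviation `ζ 0`, so it survives averaging, while the corrections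
    -- proportional to `x i - xbar` average out.
    refine tendsto_nhds_unique hq
      ((tendsto_average hx (ν q.2 q.1 + ζ 0 q.2 q.1) (unitRate p q.2)).congr fun N => ?_)
    congr 1
    refine Finset.sum_congr rfl fun j _ => ?_
    have := hz j
    simp only [hζ] at this ⊢
    linarith
  have hzero : ∀ᵐ q ∂(timeMeasure p.T μ), ζ 0 q.2 q.1 = 0 := by
    refine (hζa 0).flowL2.ae_eq_zero_of_integral_pathEnergy ?_
    have h1 := split 0 _ (hζa 0)
    -- The distortions differ by the exponential kernel applied to `γζ`; the positive kernel makes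
    -- this term reinforce the energy instead of offsetting it.
    have h2 : 0 ≤ ∫ ω, p.κ * (∫ t in (0 : ℝ)..p.T,
          (distortion p ν' t ω - distortion p ν t ω) * ζ 0 t ω) ∂μ := by
      refine integral_nonneg_of_ae ?_
      filter_upwards [ae_ae_of_ae_timeMeasure
          (q := fun ω t => ν' t ω = ν t ω + ζ 0 t ω) hflow,
        (hζa 0).flowL2.ae_pathL2, h.admissible.flowL2.ae_pathL2] with ω hω hz hn
      refine mul_nonneg p.κ_pos.le ?_
      have hd : ∀ t ∈ Set.Icc 0 p.T, (distortion p ν' t ω - distortion p ν t ω) * ζ 0 t ω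
          = p.γ * ((∫ s in (0 : ℝ)..t, Real.exp (-p.ρ * (t - s)) * ζ 0 s ω) * ζ 0 t ω) := by
        intro t ht
        have e1 : ∫ s in (0 : ℝ)..t, Real.exp (-p.ρ * (t - s)) * ν' s ω
            = ∫ s in (0 : ℝ)..t, (Real.exp (-p.ρ * (t - s)) * ν s ω
              + Real.exp (-p.ρ * (t - s)) * ζ 0 s ω) := by
          refine intervalIntegral.integral_congr_ae ?_
          rw [ae_restrict_iff' measurableSet_Icc] at hω
          filter_upwards [hω] with s hs hst
          rw [Set.uIoc_of_le ht.1] at hst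
          rw [hs ⟨hst.1.le, hst.2.trans ht.2⟩, mul_add]
        rw [intervalIntegral.integral_add
          ((hn.intervalIntegrable_sub hT.le ht).continuousOn_mul (by fun_prop))
          ((hz.intervalIntegrable_sub hT.le ht).continuousOn_mul (by fun_prop))] at e1
        simp only [distortion]
        rw [e1]; ring
      rw [integral_congr_Icc hT.le hd, intervalIntegral.integral_const_mul]
      exact mul_nonneg p.γ_pos.le
        (integral_exp_kernel_nonneg hT.le p.ρ_pos.le (hz.intervalIntegrable hT.le))
    linarith
  filter_upwards [heq i, hzero] with q h1 h2
  simp only [hζ] at h1 h2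
  linarith

end IsMeanFieldSolution

/-- Feedback form of the deterministic correction. -/
theorem feedback_eq (p : Params) {n v : ℝ → ℝ} {xbar x : ℝ} (hn : PathL2 p.T n)
    (hv : ∀ᵐ t ∂(volume.restrict (Set.Icc 0 p.T)), v t = n t + (x - xbar) * unitRate p t)
    {t : ℝ} (ht : t ∈ Set.Icc 0 p.T) :
    deriv (R p) (p.T - t) / R p (p.T - t)
      * ((xbar - ∫ s in (0 : ℝ)..t, n s) - (x - ∫ s in (0 : ℝ)..t, v s))
      = -((x - xbar) * unitRate p t) := by
  have e : ∫ s in (0 : ℝ)..t, v s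
      = (∫ s in (0 : ℝ)..t, n s) + (x - xbar) * (1 - R p (p.T - t) / R p p.T) := by
    rw [← integral_unitRate, ← intervalIntegral.integral_const_mul,
      ← intervalIntegral.integral_add (hn.intervalIntegrable_sub p.T_pos.le ht)
        (((continuous_unitRate p).intervalIntegrable _ _).const_mul _)]
    refine intervalIntegral.integral_congr_ae ?_
    rw [ae_restrict_iff' measurableSet_Icc] at hv
    filter_upwards [hv] with s hs hst
    rw [Set.uIoc_of_le ht.1] at hst
    exact hs ⟨hst.1.le, hst.2.trans ht.2⟩
  have h1 := (R_pos p (sub_nonneg.2 ht.2)).ne'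
  have h2 := (R_pos p p.T_pos.le).ne'
  rw [e, unitRate]
  field_simp
  ring

end LiquidationGame

open LiquidationGame in
theorem corollary3p7 {Ω : Type*} {mΩ : MeasurableSpace Ω}
    (μ : Measure Ω) [IsProbabilityMeasure μ]
    (ℱ : Filtration ℝ≥0 mΩ) (hℱ : UsualConditions ℱ μ)
    (p : Params)
    (P : ℝ → Ω → ℝ) (hP : IsH2 p.T ℱ μ P)
    (x : ℕ → ℝ) (xbar : ℝ)
    (hx : Tendsto (fun N : ℕ => (∑ i ∈ Finset.range N, x i) / (N : ℝ)) atTop (𝓝 xbar))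
    (X Y ν : ℝ → Ω → ℝ) (hν : IsMeanFieldSolution p ℱ μ P xbar X Y ν) :
    -- there is a Nash equilibrium with càdlàg strategies, and its net trading flow is `ν`
    (∃ v : ℕ → ℝ → Ω → ℝ, IsNashEquilibrium p ℱ μ P x v ν ∧
      ∀ i, ∀ᵐ ω ∂μ, IsCadlagOn p.T (fun t => v i t ω)) ∧
    -- every Nash equilibrium is given by the feedback formula
    (∀ (v : ℕ → ℝ → Ω → ℝ) (ν' : ℝ → Ω → ℝ), IsNashEquilibrium p ℱ μ P x v ν' →
      ∀ i,
        (∀ᵐ q ∂(timeMeasure p.T μ),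
          v i q.2 q.1 = ν q.2 q.1
            - deriv (R p) (p.T - q.2) / R p (p.T - q.2)
              * (X q.2 q.1 - inventory (x i) (v i) q.2 q.1)) ∧
        ((∀ᵐ ω ∂μ, IsCadlagOn p.T (fun t => v i t ω)) →
          ∀ᵐ ω ∂μ, ∀ t ∈ Set.Ioo 0 p.T,
            v i t ω = ν t ω
              - deriv (R p) (p.T - t) / R p (p.T - t)
                * (X t ω - inventory (x i) (v i) t ω))) ∧
    -- the coefficient of the inventory difference is well defined and positive
    (∀ t ∈ Set.Icc 0 p.T,
      0 < R p (p.T - t) ∧ 0 < deriv (R p) (p.T - t) / R p (p.T - t)) := by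
  have rate_cadlag : ∀ a, ∀ᵐ ω ∂μ, IsCadlagOn p.T (fun t => ν t ω + a * unitRate p t) := fun a =>
    (hν.cadlag hP).mono fun ω hω =>
      hω.add ((IsCadlagOn.of_continuousOn (continuous_unitRate p).continuousOn).const_mul a)
  refine ⟨⟨fun i t ω => ν t ω + (x i - xbar) * unitRate p t, ⟨fun i => ?_, hν.admissible, ?_,
    fun i w hw => hν.equilibriumRate_optimal hP (x i) hw⟩, fun i => rate_cadlag _⟩, ?_, ?_⟩
  · exact hν.admissible_equilibriumRate _
  · exact ae_of_all _ fun q => IsMeanFieldSolution.tendsto_average hx _ _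
  · intro v ν' hv i
    have hae := hν.ae_eq_of_isNashEquilibrium hP hx hv i
    have hpath := ae_ae_of_ae_timeMeasure
      (q := fun ω t => v i t ω = ν t ω + (x i - xbar) * unitRate p t) hae
    have hfb : ∀ᵐ ω ∂μ, ∀ t ∈ Set.Icc 0 p.T, deriv (R p) (p.T - t) / R p (p.T - t)
        * (X t ω - inventory (x i) (v i) t ω) = -((x i - xbar) * unitRate p t) := by
      filter_upwards [hpath, hν.forward_X, hν.admissible.flowL2.ae_pathL2] with ω h1 h2 h3 t ht
      rw [h2 t ht, inventory]
      exact feedback_eq p h3 h1 ht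
    constructor
    · filter_upwards [hae, ae_timeMeasure_of_ae (T := p.T) hfb] with q h1 h2
      rw [h2.1 _ h2.2, h1]; ring
    · intro hc
      filter_upwards [hc, rate_cadlag (x i - xbar), hpath, hfb] with ω h1 h2 h3 h4 t ht
      rw [h4 t ⟨ht.1.le, ht.2.le⟩, sub_neg_eq_add]
      -- Right continuity determines the path only before `T`; a jump at `T` is not excluded.
      exact h1.eq_of_ae_eq h2 h3 ⟨ht.1.le, ht.2⟩
  · intro t ht
    have h1 := R_pos p (sub_nonneg.2 ht.2)
    exact ⟨h1, div_pos (deriv_R_pos p (sub_nonneg.2 ht.2)) h1⟩
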